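/- All vector spaces are over $\mathbb C$. Let $a_\infty=\bar a_\infty\oplus\mathbb C c$, where $\bar a_\infty$ is the Lie algebra of matrices $(a_{ij})_{i,j\in\mathbb Z}$ with $a_{ij}=0$ for $|i-j|\gg 0$, $c$ is central, and $$[A,B]=AB-BA+C(A,B)\,c,\qquad C(A,B)=\mathrm{Trace}([J,A]B),\qquad J=\sum_{i\le 0}E_{ii}.$$ Let $a_\infty^+$ be the strictly upper triangular matrices and $a_\infty^0$ the sum of the diagonal matrices and $\mathbb Cc$. For $n\in\mathbb Z$ let ${}^a\hat\Lambda_n\in(a^0_\infty)^*$ be given by ${}^a\hat\Lambda_n(c)=1$ and $${}^a\hat\Lambda_n(\mathrm{diag}(d_i)_{i\in\mathbb Z})=\sum_{0<i\le n}d_i-\sum_{n<i\le 0}d_i .$$ Let $L(a_\infty;{}^a\hat\Lambda_n,1)$ be the irreducible highest weight module, i.e. the quotient of the Verma module of highest weight ${}^a\hat\Lambda_n$ by the sum of its proper submodules; the Verma module is $U(a_\infty)$ modulo the left ideal generated by $a_\infty^+$ and all $h-{}^a\hat\Lambda_n(h)$, $h\in a_\infty^0$. Let $F^{\otimes\frac12}$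 be the Fock space of a single neutral fermion: the module over the Clifford algebra with generators $\phi_m$, $m\in\mathbb Z+\frac12$, and relations $\{\phi_m,\phi_n\}=\delta_{m,-n}$, generated by a vacuum $|0\rangle$ subject to $\phi_m|0\rangle=0$ for $m>0$. For $n\in\mathbb Z$ let $F^{\otimes\frac12}_{(n)}$ be the span of the basis monomials $\phi_{-n_k-\frac12}\cdots\phi_{-n_1-\frac12}|0\rangle$, $n_k>\dots>n_1\ge 0$, $k\ge0$, with $\#\{i: n_i\text{ odd}\}-\#\{i: n_i\text{ even}\}=n$. Let $a_\infty$ act on $F^{\otimes\frac12}$ by the representation $r_1$ given by $r_1(c)=1$ and $$r_1\big((a_{ij})\big)=\sum_{i,j}a_{ij}\,{:}\phi_{-2i+\frac12}\phi_{2j-\frac12}{:}\,,$$ where only finitely many terms are nonzero on each vector, and ${:}\phi_{-2i+\frac12}\phi_{2j-\frac12}{:}$ is $-\phi_{2j-\frac12}\phi_{-2i+\frac12}$ if $i=j\le 0$ and $\phi_{-2i+\frac12}\phi_{2j-\frac12}$ otherwise. Let $F^{\otimes 1}$ be the Fock space of a pair of charged free fermions: the module over the Clifford algebra with generators $\psi^\pm_n$,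 $n\in\mathbb Z$, and relations $\{\psi^+_m,\psi^-_n\}=\delta_{m+n,-1}$, $\{\psi^\pm_m,\psi^\pm_n\}=0$, generated by a vacuum $|0\rangle$ subject to $\psi^\pm_n|0\rangle=0$ for $n\ge 0$. Let $a_\infty$ act on it in the standard way, $c\mapsto 1$ and $(a_{ij})\mapsto\sum_{i,j}a_{ij}\,{:}\psi^+_{-i}\psi^-_{j-1}{:}$, where ${:}\psi^+_{-i}\psi^-_{j-1}{:}$ is $-\psi^-_{j-1}\psi^+_{-i}$ if $i=j\le0$ and $\psi^+_{-i}\psi^-_{j-1}$ otherwise. **Theorem.** As $a_\infty$-modules with central charge $c=1$: for every $n\in\mathbb Z$, $F^{\otimes\frac12}_{(n)}$ is an irreducible submodule of $F^{\otimes\frac12}$ and $F^{\otimes\frac12}_{(n)}\cong L(a_\infty;{}^a\hat\Lambda_n,1)$. The space $F^{\otimes\frac12}$ is the internal direct sum of the submodules $F^{\otimes\frac12}_{(n)}$, $n\in\mathbb Z$, so that $$F^{\otimes\frac12}\cong\bigoplus_{n\in\mathbb Z}L(a_\infty;{}^a\hat\Lambda_n,1).$$ Moreover $F^{\otimes\frac12}\cong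 F^{\otimes1}$ as $a_\infty$-modules with central charge $c=1$. -/

import Mathlib

namespace FermionFock

open Filter

noncomputable section

/-- The space of complex matrices `(a i j)`, `i j : ℤ`, with `a i j = 0` for `|i - j| ≫ 0`. -/
def bandMatrices : Submodule ℂ (Matrix ℤ ℤ ℂ) where
  carrier := {A | ∃ N : ℕ, ∀ i j : ℤ, (N : ℤ) < |i - j| → A i j = 0}
  zero_mem' := ⟨0, fun _ _ _ => rfl⟩
  add_mem' := by
    rintro A B ⟨N, hN⟩ ⟨M, hM⟩
    refine ⟨max N M, fun i j h => ?_⟩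
    push_cast at h
    rw [Matrix.add_apply, hN i j (lt_of_le_of_lt (le_max_left _ _) h),
      hM i j (lt_of_le_of_lt (le_max_right _ _) h), add_zero]
  smul_mem' := by
    rintro c A ⟨N, hN⟩
    exact ⟨N, fun i j h => by rw [Matrix.smul_apply, hN i j h, smul_zero]⟩

/-- The underlying space of the Lie algebra of infinite band matrices. -/
abbrev Band : Type := ↥bandMatrices

@[ext] theorem Band.ext' {A B : Band} (h : ∀ i j, A.1 i j = B.1 i j) : A = B :=
  Subtype.ext (Matrix.ext h)

/-- Matrix multiplication: `(A B)_{ik} = ∑_j a_{ij} b_{jk}`, a sum with finitely many nonzero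
terms. -/
instance : Mul Band where
  mul A B := ⟨fun i k => ∑ᶠ j : ℤ, A.1 i j * B.1 j k, by
    obtain ⟨N, hN⟩ := A.2
    obtain ⟨M, hM⟩ := B.2
    refine ⟨N + M, fun i k h => ?_⟩
    have h0 : (fun j : ℤ => A.1 i j * B.1 j k) = fun _ => 0 := by
      funext j
      by_cases h1 : (N : ℤ) < |i - j|
      · rw [hN i j h1, zero_mul]
      · rw [hM j k, mul_zero]
        have := abs_sub_le i j k
        push_cast at h
        omega
    exact (congrArg finsum h0).trans finsum_zero⟩

theorem Band.mul_apply (A B : Band) (i k : ℤ) :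
    (A * B).1 i k = ∑ᶠ j : ℤ, A.1 i j * B.1 j k := rfl

/-- The elementary matrix `E_{mn}`. -/
def E (m n : ℤ) : Band :=
  ⟨fun i j => if i = m ∧ j = n then 1 else 0, (m - n).natAbs, fun i j h => by
    refine if_neg ?_
    rintro ⟨rfl, rfl⟩
    rw [Int.abs_eq_natAbs] at h
    exact lt_irrefl _ h⟩

/-- The diagonal matrix `J = ∑_{i ≤ 0} E_{ii}`. -/
def J : Band :=
  ⟨fun i j => if i = j ∧ i ≤ 0 then 1 else 0, 0, fun i j h => by
    refine if_neg ?_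
    rintro ⟨rfl, -⟩
    simp at h⟩

/-- The two-cocycle `C(A, B) = Trace([J, A] B)` (only finitely many diagonal entries of
`[J, A] B` are nonzero). -/
def cocycle (A B : Band) : ℂ := ∑ᶠ i : ℤ, ((J * A - A * J) * B).1 i i

/-- The indicator of `i ≤ 0`. -/
def ind (i : ℤ) : ℂ := if i ≤ 0 then 1 else 0

/-- The box `{-M, …, M}`. -/
abbrev box (M : ℕ) : Finset ℤ := Finset.Icc (-(M : ℤ)) M

theorem not_mem_box {M : ℕ} {j : ℤ} (h : j ∉ box M) : j < -(M : ℤ) ∨ (M : ℤ) < j := by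
  rw [Finset.mem_Icc] at h
  omega

theorem Band.mul_apply_eq (A B : Band) (i k : ℤ) (s : Finset ℤ)
    (h : ∀ j, j ∉ s → A.1 i j * B.1 j k = 0) :
    (A * B).1 i k = ∑ j ∈ s, A.1 i j * B.1 j k := by
  rw [Band.mul_apply]
  refine finsum_eq_sum_of_support_subset _ fun j hj => ?_
  by_contra hs
  exact hj (h j hs)

theorem Band.width (A : Band) : ∃ N : ℕ, ∀ i j : ℤ, (N : ℤ) < |i - j| → A.1 i j = 0 := A.2

theorem Band.eventually_mul_apply (A B : Band) (i k : ℤ) :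
    ∀ᶠ M in atTop, (A * B).1 i k = ∑ j ∈ box M, A.1 i j * B.1 j k := by
  obtain ⟨N, hN⟩ := A.width
  filter_upwards [eventually_ge_atTop (N + i.natAbs)] with M hM
  refine Band.mul_apply_eq A B i k _ fun j hj => ?_
  rw [hN i j, zero_mul]
  rcases not_mem_box hj with h | h
  · rw [abs_of_pos] <;> omega
  · rw [abs_of_neg] <;> omega

instance : NonUnitalRing Band where
  left_distrib A B D := by
    ext i k
    obtain ⟨M, h1, h2, h3⟩ := ((A.eventually_mul_apply (B + D) i k).and
      ((A.eventually_mul_apply B i k).and (A.eventually_mul_apply D i k))).exists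
    change (A * (B + D)).1 i k = (A * B).1 i k + (A * D).1 i k
    rw [h1, h2, h3, ← Finset.sum_add_distrib]
    exact Finset.sum_congr rfl fun j _ => mul_add _ _ _
  right_distrib A B D := by
    ext i k
    obtain ⟨M, h1, h2, h3⟩ := (((A + B).eventually_mul_apply D i k).and
      ((A.eventually_mul_apply D i k).and (B.eventually_mul_apply D i k))).exists
    change ((A + B) * D).1 i k = (A * D).1 i k + (B * D).1 i k
    rw [h1, h2, h3, ← Finset.sum_add_distrib]
    exact Finset.sum_congr rfl fun j _ => add_mul _ _ _
  zero_mul A := by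
    ext i k
    rw [Band.mul_apply_eq 0 A i k ∅ fun j _ => zero_mul _]
    rfl
  mul_zero A := by
    ext i k
    rw [Band.mul_apply_eq A 0 i k ∅ fun j _ => mul_zero _]
    rfl
  mul_assoc A B D := by
    ext i l
    obtain ⟨N, hN⟩ := A.width
    obtain ⟨K, hK⟩ := D.width
    set M : ℕ := N + K + i.natAbs + l.natAbs with hM
    have hA : ∀ j, j ∉ box M → A.1 i j = 0 := fun j hj => hN i j <| by
      rcases not_mem_box hj with h | h
      · rw [abs_of_pos] <;> omega
      · rw [abs_of_neg] <;> omega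
    have hD : ∀ j, j ∉ box M → D.1 j l = 0 := fun j hj => hK j l <| by
      rcases not_mem_box hj with h | h
      · rw [abs_of_neg] <;> omega
      · rw [abs_of_pos] <;> omega
    rw [Band.mul_apply_eq (A * B) D i l (box M) fun j hj => by rw [hD j hj, mul_zero],
      Band.mul_apply_eq A (B * D) i l (box M) fun j hj => by rw [hA j hj, zero_mul]]
    have h1 : ∀ k, (A * B).1 i k = ∑ j ∈ box M, A.1 i j * B.1 j k := fun k =>
      Band.mul_apply_eq A B i k (box M) fun j hj => by rw [hA j hj, zero_mul]
    have h2 : ∀ j, (B * D).1 j l = ∑ k ∈ box M, B.1 j k * D.1 k l := fun j =>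
      Band.mul_apply_eq B D j l (box M) fun k hk => by rw [hD k hk, mul_zero]
    simp only [h1, h2, Finset.sum_mul, Finset.mul_sum, mul_assoc]
    exact Finset.sum_comm

theorem J_bracket (A : Band) (i j : ℤ) : (J * A - A * J).1 i j = (ind i - ind j) * A.1 i j := by
  change (J * A).1 i j - (A * J).1 i j = _
  rw [Band.mul_apply_eq J A i j {i} fun k hk => by
      have hk : k ≠ i := by simpa using hk
      simp [J, hk.symm],
    Band.mul_apply_eq A J i j {j} fun k hk => by
      have hk : k ≠ j := by simpa using hk
      simp [J, hk]]
  simp [J, ind, sub_mul]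

theorem ind_eq_or {i j : ℤ} (h : ind i - ind j ≠ 0) : (i ≤ 0 ∧ 0 < j) ∨ (j ≤ 0 ∧ 0 < i) := by
  by_contra hc
  apply h
  unfold ind
  by_cases hi : i ≤ 0 <;> by_cases hj : j ≤ 0 <;> simp [hi, hj] <;> omega

theorem cocycle_eventually (A : Band) : ∀ᶠ M in atTop, ∀ B : Band,
    cocycle A B = ∑ i ∈ box M, ∑ j ∈ box M, (ind i - ind j) * A.1 i j * B.1 j i := by
  obtain ⟨N, hN⟩ := A.width
  filter_upwards [eventually_ge_atTop N] with M hM B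
  have key : ∀ i j, (i ∉ box M ∨ j ∉ box M) → (ind i - ind j) * A.1 i j = 0 := by
    intro i j hij
    by_cases h : ind i - ind j = 0
    · rw [h, zero_mul]
    · rw [hN i j, mul_zero]
      have := ind_eq_or h
      rcases hij with h' | h' <;> rcases not_mem_box h' with h' | h' <;>
        rcases abs_cases (i - j) with h'' | h'' <;> omega
  have h1 : ∀ i, ((J * A - A * J) * B).1 i i
      = ∑ j ∈ box M, (ind i - ind j) * A.1 i j * B.1 j i := by
    intro i
    rw [Band.mul_apply_eq _ B i i (box M)]
    · simp only [J_bracket]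
    · intro j hj
      rw [J_bracket, key i j (Or.inr hj), zero_mul]
  unfold cocycle
  simp only [h1]
  refine finsum_eq_sum_of_support_subset _ fun i hi => ?_
  by_contra hs
  exact hi (Finset.sum_eq_zero fun j _ => by rw [key i j (Or.inl hs), zero_mul])

theorem cocycle_add_left (A B D : Band) : cocycle (A + B) D = cocycle A D + cocycle B D := by
  obtain ⟨M, h1, h2, h3⟩ := ((cocycle_eventually (A + B)).and
    ((cocycle_eventually A).and (cocycle_eventually B))).exists
  rw [h1, h2, h3, ← Finset.sum_add_distrib]
  refine Finset.sum_congr rfl fun i _ => ?_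
  rw [← Finset.sum_add_distrib]
  refine Finset.sum_congr rfl fun j _ => ?_
  change (ind i - ind j) * (A.1 i j + B.1 i j) * D.1 j i = _
  ring

theorem cocycle_neg (A B : Band) : cocycle A B = - cocycle B A := by
  obtain ⟨M, h1, h2⟩ := ((cocycle_eventually A).and (cocycle_eventually B)).exists
  rw [h1, h2, Finset.sum_comm, ← Finset.sum_neg_distrib]
  refine Finset.sum_congr rfl fun i _ => ?_
  rw [← Finset.sum_neg_distrib]
  refine Finset.sum_congr rfl fun j _ => ?_
  ring

theorem cocycle_add_right (A B D : Band) : cocycle A (B + D) = cocycle A B + cocycle A D := by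
  rw [cocycle_neg A, cocycle_add_left, cocycle_neg B, cocycle_neg D]
  ring

theorem cocycle_smul_right (c : ℂ) (A B : Band) : cocycle A (c • B) = c * cocycle A B := by
  obtain ⟨M, h1⟩ := (cocycle_eventually A).exists
  rw [h1, h1, Finset.mul_sum]
  refine Finset.sum_congr rfl fun i _ => ?_
  rw [Finset.mul_sum]
  refine Finset.sum_congr rfl fun j _ => ?_
  change (ind i - ind j) * A.1 i j * (c * B.1 j i) = _
  ring

theorem cocycle_self (A : Band) : cocycle A A = 0 :=
  self_eq_neg.mp (cocycle_neg A A)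

theorem cocycle_mul_left (A B : Band) : ∀ᶠ M in atTop, ∀ D : Band,
    cocycle (A * B) D = ∑ i ∈ box M, ∑ j ∈ box M, ∑ k ∈ box M,
      (ind i - ind k) * (A.1 i j * B.1 j k * D.1 k i) := by
  obtain ⟨N, hN⟩ := A.width
  obtain ⟨K, hK⟩ := B.width
  filter_upwards [cocycle_eventually (A * B), eventually_ge_atTop (N + K)] with M hM hNK D
  rw [hM]
  refine Finset.sum_congr rfl fun i _ => ?_
  rw [Finset.sum_comm]
  refine Finset.sum_congr rfl fun k _ => ?_
  by_cases h : ind i - ind k = 0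
  · simp [h]
  · rw [Band.mul_apply_eq A B i k (box M), Finset.mul_sum, Finset.sum_mul]
    · exact Finset.sum_congr rfl fun j _ => by ring
    · intro j hj
      have h1 := ind_eq_or h
      by_cases h2 : (N : ℤ) < |i - j|
      · rw [hN i j h2, zero_mul]
      · rw [hK j k, mul_zero]
        rcases not_mem_box hj with h' | h' <;> rcases abs_cases (i - j) with h'' | h'' <;>
          rcases abs_cases (j - k) with h3 | h3 <;> omega

theorem cocycle_mul_right (A B D : Band) : ∀ᶠ M in atTop,
    cocycle A (B * D) = ∑ i ∈ box M, ∑ j ∈ box M, ∑ k ∈ box M,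
      (ind i - ind j) * (A.1 i j * B.1 j k * D.1 k i) := by
  filter_upwards [cocycle_mul_left B D] with M hM
  rw [cocycle_neg, hM, Finset.sum_comm_cycle, ← Finset.sum_neg_distrib]
  refine Finset.sum_congr rfl fun i _ => ?_
  rw [← Finset.sum_neg_distrib]
  refine Finset.sum_congr rfl fun j _ => ?_
  rw [← Finset.sum_neg_distrib]
  refine Finset.sum_congr rfl fun k _ => ?_
  ring

theorem cocycle_sub_left (A B D : Band) : cocycle (A - B) D = cocycle A D - cocycle B D := by
  have := cocycle_add_left (A - B) B D
  rw [sub_add_cancel] at this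
  rw [this]; ring

theorem cocycle_sub_right (A B D : Band) : cocycle A (B - D) = cocycle A B - cocycle A D := by
  have := cocycle_add_right A (B - D) D
  rw [sub_add_cancel] at this
  rw [this]; ring

theorem cocycle_leibniz (A B D : Band) :
    cocycle A (B * D - D * B)
      = cocycle (A * B - B * A) D + cocycle B (A * D - D * A) := by
  obtain ⟨M, h1, h2, h3, h4, h5, h6⟩ := ((cocycle_mul_right A B D).and
    ((cocycle_mul_right A D B).and ((cocycle_mul_left A B).and
    ((cocycle_mul_left B A).and ((cocycle_mul_right B A D).and
    (cocycle_mul_right B D A)))))).exists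
  simp only [cocycle_sub_left, cocycle_sub_right]
  rw [h1, h2, h3, h4, h5, h6]
  have e1 : ∑ i ∈ box M, ∑ j ∈ box M, ∑ k ∈ box M,
      (ind i - ind j) * (A.1 i j * D.1 j k * B.1 k i)
      = ∑ i ∈ box M, ∑ j ∈ box M, ∑ k ∈ box M,
      (ind j - ind k) * (B.1 i j * A.1 j k * D.1 k i) := by
    rw [Finset.sum_comm_cycle]
    exact Finset.sum_congr rfl fun i _ => Finset.sum_congr rfl fun j _ =>
      Finset.sum_congr rfl fun k _ => by ring
  have e2 : ∑ i ∈ box M, ∑ j ∈ box M, ∑ k ∈ box M,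
      (ind i - ind j) * (B.1 i j * D.1 j k * A.1 k i)
      = ∑ i ∈ box M, ∑ j ∈ box M, ∑ k ∈ box M,
      (ind j - ind k) * (A.1 i j * B.1 j k * D.1 k i) := by
    rw [Finset.sum_comm_cycle]
    exact Finset.sum_congr rfl fun i _ => Finset.sum_congr rfl fun j _ =>
      Finset.sum_congr rfl fun k _ => by ring
  rw [e1, e2]
  simp only [← Finset.sum_add_distrib, ← Finset.sum_sub_distrib]
  exact Finset.sum_congr rfl fun i _ => Finset.sum_congr rfl fun j _ =>
    Finset.sum_congr rfl fun k _ => by ring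

/-- The Lie algebra `a_∞`: the central extension `\bar a_∞ ⊕ ℂ c` of the Lie algebra of band
matrices. A pair `(A, s)` stands for `A + s c`. -/
def AInf : Type := Band × ℂ

namespace AInf

instance : AddCommGroup AInf := inferInstanceAs (AddCommGroup (Band × ℂ))

instance : Module ℂ AInf := inferInstanceAs (Module ℂ (Band × ℂ))

/-- The matrix part `A` of `A + s c`. -/
def mat : AInf →ₗ[ℂ] Band := LinearMap.fst ℂ Band ℂ

/-- The coefficient `s` of the central element in `A + s c`. -/
def cen : AInf →ₗ[ℂ] ℂ := LinearMap.snd ℂ Band ℂ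

/-- The inclusion `A ↦ A` of the band matrices. -/
def ofMat : Band →ₗ[ℂ] AInf := LinearMap.inl ℂ Band ℂ

/-- The central element `c`. -/
def c : AInf := ((0 : Band), (1 : ℂ))

theorem ext' {x y : AInf} (h1 : mat x = mat y) (h2 : cen x = cen y) : x = y := Prod.ext h1 h2

/-- `[A + s c, B + t c] = (A B - B A) + C(A, B) c`. -/
instance : Bracket AInf AInf where
  bracket x y := (mat x * mat y - mat y * mat x, cocycle (mat x) (mat y))

theorem mat_lie (x y : AInf) : mat ⁅x, y⁆ = mat x * mat y - mat y * mat x := rfl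

theorem cen_lie (x y : AInf) : cen ⁅x, y⁆ = cocycle (mat x) (mat y) := rfl

instance : LieRing AInf where
  add_lie x y z := by
    refine ext' ?_ ?_
    · simp only [mat_lie, map_add]; noncomm_ring
    · simp only [cen_lie, map_add, cocycle_add_left]
  lie_add x y z := by
    refine ext' ?_ ?_
    · simp only [mat_lie, map_add]; noncomm_ring
    · simp only [cen_lie, map_add, cocycle_add_right]
  lie_self x := by
    refine ext' ?_ ?_
    · simp only [mat_lie, map_zero, sub_self]
    · simp only [cen_lie, map_zero, cocycle_self]
  leibniz_lie x y z := by
    refine ext' ?_ ?_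
    · simp only [mat_lie, map_add]; noncomm_ring
    · rw [map_add, cen_lie, cen_lie, cen_lie, mat_lie, mat_lie, mat_lie]
      exact cocycle_leibniz _ _ _

end AInf

theorem Band.mul_smul' (t : ℂ) (A B : Band) : A * (t • B) = t • (A * B) := by
  ext i k
  obtain ⟨M, h1, h2⟩ := ((A.eventually_mul_apply (t • B) i k).and
    (A.eventually_mul_apply B i k)).exists
  change _ = t * (A * B).1 i k
  rw [h1, h2, Finset.mul_sum]
  refine Finset.sum_congr rfl fun j _ => ?_
  change A.1 i j * (t * B.1 j k) = _
  ring

theorem Band.smul_mul' (t : ℂ) (A B : Band) : (t • A) * B = t • (A * B) := by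
  ext i k
  obtain ⟨M, h1, h2⟩ := (((t • A).eventually_mul_apply B i k).and
    (A.eventually_mul_apply B i k)).exists
  change _ = t * (A * B).1 i k
  rw [h1, h2, Finset.mul_sum]
  refine Finset.sum_congr rfl fun j _ => ?_
  change (t * A.1 i j) * B.1 j k = _
  ring

instance : LieAlgebra ℂ AInf where
  lie_smul t x y := by
    refine AInf.ext' ?_ ?_
    · simp only [AInf.mat_lie, map_smul, Band.mul_smul', Band.smul_mul', smul_sub]
    · simp only [AInf.cen_lie, map_smul, cocycle_smul_right, smul_eq_mul]

/-! ### Highest weight modules over `a_∞` -/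

/-- `a_∞^+`: the strictly upper triangular matrices. -/
def upper : Submodule ℂ AInf where
  carrier := {x | AInf.cen x = 0 ∧ ∀ i j : ℤ, j ≤ i → (AInf.mat x).1 i j = 0}
  zero_mem' := ⟨rfl, fun _ _ _ => rfl⟩
  add_mem' := by
    rintro x y ⟨hx, hx'⟩ ⟨hy, hy'⟩
    refine ⟨by rw [map_add, hx, hy, add_zero], fun i j h => ?_⟩
    change (AInf.mat x).1 i j + (AInf.mat y).1 i j = 0
    rw [hx' i j h, hy' i j h, add_zero]
  smul_mem' := by
    rintro t x ⟨hx, hx'⟩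
    refine ⟨by rw [map_smul, hx, smul_zero], fun i j h => ?_⟩
    change t * (AInf.mat x).1 i j = 0
    rw [hx' i j h, mul_zero]

/-- `a_∞^0 = gl_0 ⊕ ℂ c`, where `gl_0` consists of the diagonal matrices. -/
def cartan : Submodule ℂ AInf where
  carrier := {x | ∀ i j : ℤ, i ≠ j → (AInf.mat x).1 i j = 0}
  zero_mem' := fun _ _ _ => rfl
  add_mem' := by
    intro x y hx hy i j h
    change (AInf.mat x).1 i j + (AInf.mat y).1 i j = 0
    rw [hx i j h, hy i j h, add_zero]
  smul_mem' := by
    intro t x hx i j h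
    change t * (AInf.mat x).1 i j = 0
    rw [hx i j h, mul_zero]

/-- The linear functional `D + s c ↦ d_i` on `a_∞^0`, for `D = diag(d_i)`. -/
def diagEntry (i : ℤ) : Module.Dual ℂ cartan where
  toFun h := (AInf.mat h.1).1 i i
  map_add' _ _ := rfl
  map_smul' _ _ := rfl

/-- The weight `Λ_n`, with `Λ_n(E_{ii}) = 1` for `0 < i ≤ n`, `Λ_n(E_{ii}) = -1` for `n < i ≤ 0`,
`Λ_n(E_{ii}) = 0` otherwise, and `Λ_n(c) = 0`; on a diagonal matrix with infinitely many nonzero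
entries it is the finite sum `∑_{0 < i ≤ n} d_i - ∑_{n < i ≤ 0} d_i`. -/
def weight (n : ℤ) : Module.Dual ℂ cartan :=
  ∑ i ∈ Finset.Ioc 0 n, diagEntry i - ∑ i ∈ Finset.Ioc n 0, diagEntry i

/-- The weight with value `1` on `c` and `0` on all diagonal matrices. -/
def weightHatZero : Module.Dual ℂ cartan where
  toFun h := AInf.cen h.1
  map_add' _ _ := map_add _ _ _
  map_smul' _ _ := map_smul _ _ _

/-- The `n`-th fundamental weight. -/
def weightHat (n : ℤ) : Module.Dual ℂ cartan := weight n + weightHatZero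

/-- The universal enveloping algebra of `a_∞`. -/
abbrev UAInf : Type := UniversalEnvelopingAlgebra ℂ AInf

/-- The left ideal of `U(a_∞)` generated by `a_∞^+` and the elements `h - Λ(h)`, `h ∈ a_∞^0`. -/
def vermaIdeal (Λ : Module.Dual ℂ cartan) : Submodule UAInf UAInf :=
  Submodule.span UAInf
    ({u | ∃ x ∈ upper, u = UniversalEnvelopingAlgebra.ι ℂ x} ∪
      {u | ∃ h : cartan, u = UniversalEnvelopingAlgebra.ι ℂ h.1 - algebraMap ℂ UAInf (Λ h)})

/-- The Verma module of `a_∞` with highest weight `Λ` (and central charge `Λ(c)`). -/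
abbrev Verma (Λ : Module.Dual ℂ cartan) : Type := UAInf ⧸ vermaIdeal Λ

/-- The irreducible highest weight module `L(a_∞; Λ, Λ(c))`: the quotient of the Verma module by the
sum of its proper submodules. -/
def Irr (Λ : Module.Dual ℂ cartan) : Type :=
  Verma Λ ⧸ sSup {N : Submodule UAInf (Verma Λ) | N ≠ ⊤}

namespace Irr

variable (Λ : Module.Dual ℂ cartan)

instance : AddCommGroup (Irr Λ) :=
  inferInstanceAs (AddCommGroup (Verma Λ ⧸ sSup {N : Submodule UAInf (Verma Λ) | N ≠ ⊤}))

instance : Module UAInf (Irr Λ) :=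
  inferInstanceAs (Module UAInf (Verma Λ ⧸ sSup {N : Submodule UAInf (Verma Λ) | N ≠ ⊤}))

instance : Module ℂ (Irr Λ) :=
  inferInstanceAs (Module ℂ (Verma Λ ⧸ sSup {N : Submodule UAInf (Verma Λ) | N ≠ ⊤}))

instance : IsScalarTower ℂ UAInf (Irr Λ) :=
  inferInstanceAs (IsScalarTower ℂ UAInf
    (Verma Λ ⧸ sSup {N : Submodule UAInf (Verma Λ) | N ≠ ⊤}))

/-- `x ∈ a_∞` acts as its image in `U(a_∞)`. -/
instance : LieRingModule AInf (Irr Λ) where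
  bracket x v := UniversalEnvelopingAlgebra.ι ℂ x • v
  add_lie x y v := by
    change UniversalEnvelopingAlgebra.ι ℂ (x + y) • v = _
    rw [map_add, add_smul]
  lie_add x v w := smul_add _ _ _
  leibniz_lie x y v := by
    let _ : LieRing UAInf := LieRing.ofAssociativeRing
    change UniversalEnvelopingAlgebra.ι ℂ x • UniversalEnvelopingAlgebra.ι ℂ y • v
      = UniversalEnvelopingAlgebra.ι ℂ ⁅x, y⁆ • v
        + UniversalEnvelopingAlgebra.ι ℂ y • UniversalEnvelopingAlgebra.ι ℂ x • v
    rw [LieHom.map_lie, LieRing.of_associative_ring_bracket, sub_smul, mul_smul, mul_smul,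
      sub_add_cancel]

instance : LieModule ℂ AInf (Irr Λ) where
  smul_lie t x v := by
    change UniversalEnvelopingAlgebra.ι ℂ (t • x) • v = t • UniversalEnvelopingAlgebra.ι ℂ x • v
    rw [map_smul, smul_assoc]
  lie_smul t x v := by
    change UniversalEnvelopingAlgebra.ι ℂ x • t • v = t • UniversalEnvelopingAlgebra.ι ℂ x • v
    rw [← algebraMap_smul UAInf t v, ← algebraMap_smul UAInf t
      (UniversalEnvelopingAlgebra.ι ℂ x • v), ← mul_smul, ← mul_smul, Algebra.commutes]

end Irr

/-! ### The action of `a_∞` by normally ordered quadratic expressions in fermions -/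

/-- Operators `a_i` and `b_j` (`i, j : ℤ`) with `{a_i, b_j} = δ_{ij}`, `{a_i, a_j} = {b_i, b_j} = 0`,
such that every vector is annihilated by `b_j` for `j ≫ 0` and by `a_i` for `i ≪ 0`. The two Fock
spaces below are shown to carry such operators. -/
structure FermionPair (F : Type) [AddCommGroup F] [Module ℂ F] where
  a : ℤ → Module.End ℂ F
  b : ℤ → Module.End ℂ F
  ab : ∀ i j, a i * b j + b j * a i = if i = j then 1 else 0
  aa : ∀ i j, a i * a j + a j * a i = 0
  bb : ∀ i j, b i * b j + b j * b i = 0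
  fin : ∀ v : F, ∃ N : ℕ, (∀ j : ℤ, (N : ℤ) < j → b j v = 0) ∧ ∀ i : ℤ, i < -(N : ℤ) → a i v = 0

namespace FermionPair

variable {F : Type} [AddCommGroup F] [Module ℂ F] (m : FermionPair F)

/-- The normal ordered product `:a_i b_j:`. -/
def nop (i j : ℤ) : Module.End ℂ F :=
  if i = j ∧ i ≤ 0 then -(m.b j * m.a i) else m.a i * m.b j

theorem nop_eq (i j : ℤ) : m.nop i j = m.a i * m.b j - (if i = j then ind i else 0) • 1 := by
  unfold nop ind
  have h := m.ab i j
  by_cases hij : i = j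
  · by_cases hi : i ≤ 0
    · rw [if_pos ⟨hij, hi⟩, if_pos hij, if_pos hi, one_smul]
      rw [if_pos hij] at h
      rw [← h]
      abel
    · rw [if_neg fun hc => hi hc.2, if_pos hij, if_neg hi, zero_smul, sub_zero]
  · rw [if_neg fun hc => hij hc.1, if_neg hij, zero_smul, sub_zero]

theorem fin_nop (v : F) : ∃ N : ℕ, ∀ i j : ℤ, (i < -(N : ℤ) ∨ (N : ℤ) < j) → m.nop i j v = 0 := by
  obtain ⟨N, hb, ha⟩ := m.fin v
  refine ⟨N, fun i j hij => ?_⟩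
  unfold nop
  split_ifs with h
  · rw [LinearMap.neg_apply, Module.End.mul_apply]
    rw [ha i (by omega), map_zero, neg_zero]
  · rcases hij with hi | hj
    · have h2 : i ≠ j := fun hc => h ⟨hc, by omega⟩
      have h3 := LinearMap.congr_fun (m.ab i j) v
      rw [if_neg h2, LinearMap.add_apply, Module.End.mul_apply, Module.End.mul_apply, ha i hi,
        map_zero, add_zero] at h3
      exact h3
    · rw [Module.End.mul_apply, hb j hj, map_zero]

theorem a_comm (i j : ℤ) : m.a i * m.a j = -(m.a j * m.a i) := eq_neg_of_add_eq_zero_left (m.aa i j)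

theorem b_comm (i j : ℤ) : m.b i * m.b j = -(m.b j * m.b i) := eq_neg_of_add_eq_zero_left (m.bb i j)

theorem b_a (i j : ℤ) : m.b j * m.a i = (if i = j then (1 : ℂ) else 0) • 1 - m.a i * m.b j := by
  rw [eq_sub_iff_add_eq, add_comm, m.ab i j]
  split_ifs <;> simp

theorem quad (i j k l : ℤ) : (m.a i * m.b j) * (m.a k * m.b l)
    = (if k = j then (1 : ℂ) else 0) • (m.a i * m.b l) - m.a i * m.a k * (m.b j * m.b l) := by
  have : (m.a i * m.b j) * (m.a k * m.b l) = m.a i * (m.b j * m.a k) * m.b l := by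
    noncomm_ring
  rw [this, m.b_a, mul_sub, sub_mul, mul_smul_comm, smul_mul_assoc, mul_one]
  noncomm_ring

theorem nop_comm (i j k l : ℤ) : m.nop i j * m.nop k l - m.nop k l * m.nop i j
    = (if k = j then (1 : ℂ) else 0) • m.nop i l - (if i = l then (1 : ℂ) else 0) • m.nop k j
      + (if k = j then (if i = l then ind i - ind j else 0) else 0) • 1 := by
  have h0 : m.nop i j * m.nop k l - m.nop k l * m.nop i j
      = (m.a i * m.b j) * (m.a k * m.b l) - (m.a k * m.b l) * (m.a i * m.b j) := by
    simp only [nop_eq, mul_sub, sub_mul, mul_smul_comm, smul_mul_assoc, mul_one, one_mul]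
    module
  have h1 : m.a i * m.a k * (m.b j * m.b l) = m.a k * m.a i * (m.b l * m.b j) := by
    rw [m.a_comm i k, m.b_comm j l, neg_mul_neg]
  rw [h0, quad, quad, h1, nop_eq, nop_eq]
  by_cases h2 : k = j <;> by_cases h3 : i = l <;> simp [h2, h3, sub_smul] <;> abel

/-- The action of a band matrix: `A ↦ ∑_{i,j} a_{ij} :a_i b_j:`, where on each vector only finitely
many terms are nonzero. -/
def act (A : Band) (v : F) : F := ∑ᶠ p : ℤ × ℤ, A.1 p.1 p.2 • m.nop p.1 p.2 v

theorem act_eventually (A : Band) (v : F) : ∀ᶠ M in atTop,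
    m.act A v = ∑ i ∈ box M, ∑ j ∈ box M, A.1 i j • m.nop i j v := by
  obtain ⟨N, hN⟩ := m.fin_nop v
  obtain ⟨K, hK⟩ := A.width
  filter_upwards [eventually_ge_atTop (N + K)] with M hM
  rw [← Finset.sum_product']
  refine finsum_eq_sum_of_support_subset _ fun p hp => ?_
  by_contra hs
  apply hp
  change A.1 p.1 p.2 • m.nop p.1 p.2 v = 0
  by_cases h1 : (K : ℤ) < |p.1 - p.2|
  · rw [hK _ _ h1, zero_smul]
  · rw [hN, smul_zero]
    by_contra hc
    apply hs
    rw [Finset.mem_coe, Finset.mem_product, Finset.mem_Icc, Finset.mem_Icc]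
    rcases abs_cases (p.1 - p.2) with h | h <;> omega

theorem act_add_left (A B : Band) (v : F) : m.act (A + B) v = m.act A v + m.act B v := by
  obtain ⟨M, h1, h2, h3⟩ := ((m.act_eventually (A + B) v).and
    ((m.act_eventually A v).and (m.act_eventually B v))).exists
  rw [h1, h2, h3]
  simp only [← Finset.sum_add_distrib]
  exact Finset.sum_congr rfl fun i _ => Finset.sum_congr rfl fun j _ => add_smul _ _ _

theorem act_smul_left (t : ℂ) (A : Band) (v : F) : m.act (t • A) v = t • m.act A v := by
  obtain ⟨M, h1, h2⟩ := ((m.act_eventually (t • A) v).and (m.act_eventually A v)).exists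
  rw [h1, h2]
  simp only [Finset.smul_sum]
  exact Finset.sum_congr rfl fun i _ => Finset.sum_congr rfl fun j _ => mul_smul _ _ _

theorem act_add_right (A : Band) (v w : F) : m.act A (v + w) = m.act A v + m.act A w := by
  obtain ⟨M, h1, h2, h3⟩ := ((m.act_eventually A (v + w)).and
    ((m.act_eventually A v).and (m.act_eventually A w))).exists
  rw [h1, h2, h3]
  simp only [← Finset.sum_add_distrib, map_add, smul_add]

theorem act_smul_right (t : ℂ) (A : Band) (v : F) : m.act A (t • v) = t • m.act A v := by
  obtain ⟨M, h1, h2⟩ := ((m.act_eventually A (t • v)).and (m.act_eventually A v)).exists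
  rw [h1, h2]
  simp only [Finset.smul_sum, map_smul]
  exact Finset.sum_congr rfl fun i _ => Finset.sum_congr rfl fun j _ => smul_comm _ _ _

theorem act_sub_left (A B : Band) (v : F) : m.act (A - B) v = m.act A v - m.act B v := by
  have := m.act_add_left (A - B) B v
  rw [sub_add_cancel] at this
  rw [this, add_sub_cancel_right]

theorem act_mul_eventually (A B : Band) (v : F) : ∀ᶠ M in atTop,
    m.act (A * B) v
      = ∑ i ∈ box M, ∑ l ∈ box M, ∑ j ∈ box M, (A.1 i j * B.1 j l) • m.nop i l v := by
  obtain ⟨N, hN⟩ := m.fin_nop v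
  obtain ⟨K, hK⟩ := A.width
  obtain ⟨K', hK'⟩ := B.width
  filter_upwards [m.act_eventually (A * B) v, eventually_ge_atTop (N + K + K')] with M h1 hM
  rw [h1]
  refine Finset.sum_congr rfl fun i _ => Finset.sum_congr rfl fun l _ => ?_
  rw [← Finset.sum_smul]
  by_cases h : i < -(N : ℤ) ∨ (N : ℤ) < l
  · rw [hN i l h, smul_zero, smul_zero]
  · rw [Band.mul_apply_eq A B i l (box M)]
    intro j hj
    by_cases h2 : (K : ℤ) < |i - j|
    · rw [hK i j h2, zero_mul]
    · rw [hK' j l, mul_zero]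
      rcases not_mem_box hj with h' | h' <;> rcases abs_cases (i - j) with h3 | h3 <;>
        rcases abs_cases (j - l) with h4 | h4 <;> omega

/-- The operators `:a_i b_j:` represent `a_∞` with central charge `1`. -/
theorem act_comm (A B : Band) (v : F) : m.act A (m.act B v) - m.act B (m.act A v)
    = m.act (A * B - B * A) v + cocycle A B • v := by
  obtain ⟨M, h1, h2, h3, h4, h5, h6, h7⟩ := ((m.act_eventually A v).and
    ((m.act_eventually B v).and ((m.act_eventually A (m.act B v)).and
    ((m.act_eventually B (m.act A v)).and ((m.act_mul_eventually A B v).and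
    ((m.act_mul_eventually B A v).and (cocycle_eventually A))))))).exists
  have e1 : m.act A (m.act B v) = ∑ i ∈ box M, ∑ j ∈ box M, ∑ k ∈ box M, ∑ l ∈ box M,
      (A.1 i j * B.1 k l) • (m.nop i j * m.nop k l) v := by
    rw [h3, h2]
    simp only [map_sum, map_smul, Finset.smul_sum, mul_smul, Module.End.mul_apply]
  have e2 : m.act B (m.act A v) = ∑ i ∈ box M, ∑ j ∈ box M, ∑ k ∈ box M, ∑ l ∈ box M,
      (A.1 i j * B.1 k l) • (m.nop k l * m.nop i j) v := by
    rw [h4, h1]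
    simp only [map_sum, map_smul, Finset.smul_sum, Module.End.mul_apply, smul_smul]
    simp only [← Finset.sum_product' (box M) (box M)]
    rw [Finset.sum_comm]
    exact Finset.sum_congr rfl fun p _ => Finset.sum_congr rfl fun q _ => by rw [mul_comm]
  have e3 : ∀ i j k l : ℤ, (A.1 i j * B.1 k l) • (m.nop i j * m.nop k l) v
      - (A.1 i j * B.1 k l) • (m.nop k l * m.nop i j) v
      = (if k = j then (A.1 i j * B.1 k l) • m.nop i l v else 0)
        - (if i = l then (A.1 i j * B.1 k l) • m.nop k j v else 0)
        + (if k = j then if i = l then ((ind i - ind j) * A.1 i j * B.1 k l) • v else 0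
            else 0) := by
    intro i j k l
    rw [← smul_sub, ← LinearMap.sub_apply, m.nop_comm]
    by_cases hk : k = j <;> by_cases hl : i = l <;> simp [hk, hl]
    module
  rw [e1, e2, act_sub_left, h5, h6, h7]
  simp only [← Finset.sum_sub_distrib, e3]
  simp only [Finset.sum_sub_distrib, Finset.sum_add_distrib, Finset.sum_smul]
  congr 1
  · congr 1
    · refine Finset.sum_congr rfl fun i _ => ?_
      rw [Finset.sum_comm (s := box M) (t := box M)
        (f := fun l j => (A.1 i j * B.1 j l) • m.nop i l v)]
      refine Finset.sum_congr rfl fun j hj => ?_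
      rw [Finset.sum_comm]
      refine Finset.sum_congr rfl fun l _ => ?_
      rw [Finset.sum_ite_eq' (box M) j, if_pos hj]
    · rw [Finset.sum_congr rfl fun i hi => Finset.sum_congr rfl fun j _ =>
        Finset.sum_congr rfl fun k _ => by
          rw [Finset.sum_ite_eq (box M) i, if_pos hi]]
      rw [Finset.sum_comm_cycle]
      refine Finset.sum_congr rfl fun k _ => ?_
      rw [Finset.sum_comm]
      exact Finset.sum_congr rfl fun j _ => Finset.sum_congr rfl fun i _ => by rw [mul_comm]
  · refine Finset.sum_congr rfl fun i hi => Finset.sum_congr rfl fun j hj => ?_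
    rw [Finset.sum_comm]
    rw [Finset.sum_congr rfl fun l _ => by rw [Finset.sum_ite_eq' (box M) j, if_pos hj]]
    rw [Finset.sum_ite_eq (box M) i, if_pos hi]

/-- A central charge `1` representation of `a_∞`: `E_{ij} ↦ :a_i b_j:` and `c ↦ 1`. -/
@[reducible] def lieRingModule : LieRingModule AInf F where
  bracket x v := m.act (AInf.mat x) v + AInf.cen x • v
  add_lie x y v := by
    rw [map_add, map_add, act_add_left, add_smul]
    abel
  lie_add x v w := by
    rw [act_add_right, smul_add]
    abel
  leibniz_lie x y v := by
    rw [AInf.mat_lie, AInf.cen_lie]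
    have h := m.act_comm (AInf.mat x) (AInf.mat y) v
    simp only [act_add_right, act_smul_right, smul_add]
    rw [sub_eq_iff_eq_add] at h
    rw [h, smul_comm (AInf.cen x) (AInf.cen y)]
    abel

theorem lieModule : @LieModule ℂ AInf F _ _ _ _ _ m.lieRingModule := by
  let _ : LieRingModule AInf F := m.lieRingModule
  refine ⟨fun t x v => ?_, fun t x v => ?_⟩
  · change m.act (AInf.mat (t • x)) v + AInf.cen (t • x) • v
      = t • (m.act (AInf.mat x) v + AInf.cen x • v)
    rw [map_smul, map_smul, act_smul_left, smul_assoc, smul_add]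
  · change m.act (AInf.mat x) (t • v) + AInf.cen x • t • v
      = t • (m.act (AInf.mat x) v + AInf.cen x • v)
    rw [act_smul_right, smul_comm, smul_add]

/-- `E_{ij}` acts as `:a_i b_j:`. -/
theorem act_E (i j : ℤ) (v : F) : m.act (E i j) v = m.nop i j v := by
  unfold act
  rw [finsum_eq_single _ (i, j)]
  · change (if i = i ∧ j = j then (1 : ℂ) else 0) • m.nop i j v = _
    rw [if_pos ⟨rfl, rfl⟩, one_smul]
  · rintro ⟨k, l⟩ h
    change (if k = i ∧ l = j then (1 : ℂ) else 0) • m.nop k l v = 0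
    rw [if_neg fun hc => h (Prod.ext hc.1 hc.2), zero_smul]

end FermionPair

/-! ### Clifford algebras and Fock spaces -/

section Fock

variable {X : Type} (β : X → X → ℂ)

/-- The quadratic form on the space with basis `X` for which the generators of the Clifford algebra
satisfy `x y + y x = β(x, y)`, for symmetric `β`. -/
def cliffForm : QuadraticForm ℂ (X →₀ ℂ) :=
  (1 / 2 : ℂ) • LinearMap.BilinMap.toQuadraticMap
    (Finsupp.linearCombination ℂ fun x => Finsupp.linearCombination ℂ (β x))

/-- The Clifford algebra with generators `x : X` and relations `x y + y x = β(x, y)`. -/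
abbrev Cliff : Type := CliffordAlgebra (cliffForm β)

/-- The generators. -/
def gen (x : X) : Cliff β := CliffordAlgebra.ι (cliffForm β) (Finsupp.single x 1)

theorem gen_anticomm (hβ : ∀ x y, β x y = β y x) (x y : X) :
    gen β x * gen β y + gen β y * gen β x = algebraMap ℂ (Cliff β) (β x y) := by
  unfold gen
  rw [CliffordAlgebra.ι_mul_ι_add_swap]
  congr 1
  unfold cliffForm
  rw [FunLike.coe_smul, QuadraticMap.polar_smul, LinearMap.BilinMap.polar_toQuadraticMap]
  simp [hβ y x]
  ring

/-- The left ideal generated by the annihilation operators `x ∈ P`. -/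
abbrev vacIdeal (P : Set X) : Submodule (Cliff β) (Cliff β) :=
  Submodule.span (Cliff β) (gen β '' P)

/-- The highest weight module of the Clifford algebra generated by a vacuum vector `|0⟩` with the
relations `x |0⟩ = 0` for `x ∈ P`. -/
def Fock (P : Set X) : Type := Cliff β ⧸ vacIdeal β P

variable (P : Set X)

instance : AddCommGroup (Fock β P) := inferInstanceAs (AddCommGroup (Cliff β ⧸ vacIdeal β P))

instance : Module (Cliff β) (Fock β P) :=
  inferInstanceAs (Module (Cliff β) (Cliff β ⧸ vacIdeal β P))

instance : Module ℂ (Fock β P) := inferInstanceAs (Module ℂ (Cliff β ⧸ vacIdeal β P))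

instance : IsScalarTower ℂ (Cliff β) (Fock β P) :=
  inferInstanceAs (IsScalarTower ℂ (Cliff β) (Cliff β ⧸ vacIdeal β P))

/-- The vacuum vector `|0⟩`. -/
def vac : Fock β P := Submodule.Quotient.mk (p := vacIdeal β P) 1

/-- The operator on the Fock space given by a generator of the Clifford algebra. -/
def op (x : X) : Module.End ℂ (Fock β P) := Algebra.lsmul ℂ ℂ (Fock β P) (gen β x)

theorem op_anticomm (hβ : ∀ x y, β x y = β y x) (x y : X) :
    op β P x * op β P y + op β P y * op β P x = β x y • 1 := by
  unfold op
  rw [← map_mul, ← map_mul, ← map_add, gen_anticomm β hβ, AlgHom.commutes,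
    Algebra.algebraMap_eq_smul_one]

theorem op_vac {x : X} (hx : x ∈ P) : op β P x (vac β P) = 0 := by
  change Submodule.Quotient.mk (p := vacIdeal β P) (gen β x • 1) = 0
  rw [Submodule.Quotient.mk_eq_zero, smul_eq_mul, mul_one]
  exact Submodule.subset_span ⟨x, hx, rfl⟩

theorem fock_induction {p : Fock β P → Prop} (h0 : p 0) (hv : p (vac β P))
    (ha : ∀ v w, p v → p w → p (v + w)) (hs : ∀ (t : ℂ) v, p v → p (t • v))
    (ho : ∀ x v, p v → p (op β P x v)) (v : Fock β P) : p v := by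
  obtain ⟨u, rfl⟩ := Submodule.Quotient.mk_surjective (vacIdeal β P) v
  induction u using CliffordAlgebra.left_induction with
  | algebraMap r =>
    rw [Algebra.algebraMap_eq_smul_one]
    exact hs r _ hv
  | add x y hx hy => exact ha _ _ hx hy
  | ι_mul u f hu =>
    induction f using Finsupp.induction_linear with
    | zero =>
      rw [map_zero, zero_mul]
      exact h0
    | add f g hf hg =>
      rw [map_add, add_mul]
      exact ha _ _ hf hg
    | single x t =>
      have : CliffordAlgebra.ι (cliffForm β) (Finsupp.single x t) = t • gen β x := by
        rw [gen, ← map_smul, Finsupp.smul_single, smul_eq_mul, mul_one]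
      rw [this, smul_mul_assoc]
      exact hs t _ (ho x _ hu)

variable {β P}

/-- Creation and annihilation operators `a_i = α(i)`, `b_j = γ(j)` on a Fock space. -/
def Fock.pair (hβ : ∀ x y, β x y = β y x) (α γ : ℤ → X)
    (hαγ : ∀ i j, β (α i) (γ j) = if i = j then 1 else 0)
    (hαα : ∀ i j, β (α i) (α j) = 0) (hγγ : ∀ i j, β (γ i) (γ j) = 0)
    (hα : ∀ i ≤ 0, α i ∈ P) (hγ : ∀ j > 0, γ j ∈ P)
    (hX : ∀ x, (∃ i, x = α i) ∨ ∃ j, x = γ j) : FermionPair (Fock β P) where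
  a i := op β P (α i)
  b j := op β P (γ j)
  ab i j := by
    rw [op_anticomm β P hβ, hαγ]
    split_ifs <;> simp
  aa i j := by rw [op_anticomm β P hβ, hαα, zero_smul]
  bb i j := by rw [op_anticomm β P hβ, hγγ, zero_smul]
  fin v := by
    have key : ∀ x y v, op β P x v = 0 → β x y = 0 → op β P x (op β P y v) = 0 := by
      intro x y v h1 h2
      have h := LinearMap.congr_fun (op_anticomm β P hβ x y) v
      rw [h2, zero_smul, LinearMap.add_apply, Module.End.mul_apply, Module.End.mul_apply, h1,
        map_zero, add_zero] at h
      exact h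
    induction v using fock_induction with
    | h0 => exact ⟨0, fun j _ => map_zero _, fun i _ => map_zero _⟩
    | hv =>
      exact ⟨0, fun j hj => op_vac β P (hγ j (by simpa using hj)),
        fun i hi => op_vac β P (hα i (by simp at hi; omega))⟩
    | ha v w hv hw =>
      obtain ⟨N, h1, h2⟩ := hv
      obtain ⟨M, h3, h4⟩ := hw
      refine ⟨N + M, fun j hj => ?_, fun i hi => ?_⟩
      · rw [map_add, h1 j (by omega), h3 j (by omega), add_zero]
      · rw [map_add, h2 i (by omega), h4 i (by omega), add_zero]
    | hs t v hv =>
      obtain ⟨N, h1, h2⟩ := hv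
      refine ⟨N, fun j hj => ?_, fun i hi => ?_⟩
      · rw [map_smul, h1 j hj, smul_zero]
      · rw [map_smul, h2 i hi, smul_zero]
    | ho x v hv =>
      obtain ⟨N, h1, h2⟩ := hv
      rcases hX x with ⟨k, rfl⟩ | ⟨k, rfl⟩
      · refine ⟨N + k.natAbs, fun j hj => ?_, fun i hi => ?_⟩
        · exact key _ _ _ (h1 j (by omega)) (by rw [hβ, hαγ, if_neg (by omega)])
        · exact key _ _ _ (h2 i (by omega)) (hαα _ _)
      · refine ⟨N + k.natAbs, fun j hj => ?_, fun i hi => ?_⟩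
        · exact key _ _ _ (h1 j (by omega)) (hγγ _ _)
        · exact key _ _ _ (h2 i (by omega)) (by rw [hαγ, if_neg (by omega)])

end Fock

/-! ### The Fock space of a single neutral fermion -/

/-- `{φ_{k - 1/2}, φ_{l - 1/2}} = δ_{k + l, 1}`; the integer `k` stands for the mode
`φ_{k - 1/2}`. -/
def neutralForm (k l : ℤ) : ℂ := if k + l = 1 then 1 else 0

/-- The Fock space `F^{⊗ 1/2}` of a single neutral fermion: the vacuum is annihilated by the modes
`φ_{k - 1/2}` with `k - 1/2 > 0`. -/
def NeutralFock : Type := Fock neutralForm {k : ℤ | 1 ≤ k}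

namespace NeutralFock

instance : AddCommGroup NeutralFock := inferInstanceAs (AddCommGroup (Fock _ _))

instance : Module ℂ NeutralFock := inferInstanceAs (Module ℂ (Fock _ _))

/-- The vacuum vector. -/
def vacuum : NeutralFock := vac _ _

/-- The operator `φ_{k - 1/2}`. -/
def phi (k : ℤ) : Module.End ℂ NeutralFock := op neutralForm {k : ℤ | 1 ≤ k} k

/-- The operators `a_i = φ_{-2i + 1/2}` and `b_j = φ_{2j - 1/2}`. -/
def pair : FermionPair NeutralFock :=
  Fock.pair (β := neutralForm) (P := {k : ℤ | 1 ≤ k})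
    (fun k l => by simp only [neutralForm, add_comm])
    (fun i => -2 * i + 1) (fun j => 2 * j)
    (fun i j => if_congr (by omega) rfl rfl)
    (fun i j => if_neg (by omega)) (fun i j => if_neg (by omega))
    (fun i hi => by change 1 ≤ -2 * i + 1; omega)
    (fun j hj => by change 1 ≤ 2 * j; omega)
    (fun x => by
      rcases Int.even_or_odd' x with ⟨k, hk | hk⟩
      · exact Or.inr ⟨k, hk⟩
      · exact Or.inl ⟨-k, by omega⟩)

theorem pair_a (i : ℤ) : pair.a i = phi (-2 * i + 1) := rfl

theorem pair_b (j : ℤ) : pair.b j = phi (2 * j) := rfl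

/-- The representation `r_1` of `a_∞`: `E_{ij} ↦ :φ_{-2i + 1/2} φ_{2j - 1/2}:`, `c ↦ 1`. -/
instance : LieRingModule AInf NeutralFock := pair.lieRingModule

instance : LieModule ℂ AInf NeutralFock := pair.lieModule

theorem lie_eq (x : AInf) (v : NeutralFock) :
    ⁅x, v⁆ = pair.act (AInf.mat x) v + AInf.cen x • v := rfl

theorem phi_anticomm (k l : ℤ) : phi k * phi l + phi l * phi k = neutralForm k l • 1 :=
  op_anticomm neutralForm {k : ℤ | 1 ≤ k} (fun k l => by simp only [neutralForm, add_comm]) k l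

theorem phi_vacuum {k : ℤ} (hk : 1 ≤ k) : phi k vacuum = 0 := op_vac neutralForm {k : ℤ | 1 ≤ k} hk

/-- The monomial `φ_{k_1 - 1/2} ⋯ φ_{k_r - 1/2} |0⟩`. -/
def word (l : List ℤ) : NeutralFock := (l.map phi).prod vacuum

/-- The lists `k_1 < ⋯ < k_r ≤ 0`; the corresponding monomials
`φ_{k_1 - 1/2} ⋯ φ_{k_r - 1/2} |0⟩` form the standard basis of the Fock space. -/
def Ordered (l : List ℤ) : Prop := l.Pairwise (· < ·) ∧ ∀ k ∈ l, k ≤ 0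

/-- The degree of the monomial `φ_{k_1 - 1/2} ⋯ φ_{k_r - 1/2} |0⟩`: the number of odd `k_i` minus the
number of even `k_i`. -/
def deg (l : List ℤ) : ℤ :=
  (l.countP fun k => decide (Odd k) : ℤ) - (l.countP fun k => decide (Even k) : ℤ)

/-- The degree component `F_{(n)}` as a subspace: the span of the standard basis monomials of
degree `n`. -/
def homog (n : ℤ) : Submodule ℂ NeutralFock :=
  Submodule.span ℂ {v | ∃ l, Ordered l ∧ deg l = n ∧ v = word l}

theorem word_cons (k : ℤ) (l : List ℤ) : word (k :: l) = phi k (word l) := by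
  rw [word, word, List.map_cons, List.prod_cons, Module.End.mul_apply]

theorem deg_cons (k : ℤ) (l : List ℤ) : deg (k :: l) = (if Odd k then 1 else -1) + deg l := by
  unfold deg
  rw [List.countP_cons, List.countP_cons]
  by_cases hk : Odd k
  · have := Int.not_even_iff_odd.mpr hk
    simp [hk, this]
    omega
  · have := Int.not_odd_iff_even.mp hk
    simp [hk, this]
    omega

theorem phi_word (l : List ℤ) : ∀ y : ℤ, Ordered l → (∀ x ∈ l, y < x) → ∀ k, y < k →
    phi k (word l) ∈ Submodule.span ℂ
      {v | ∃ l', Ordered l' ∧ (∀ x ∈ l', y < x) ∧ deg l' = deg (k :: l) ∧ v = word l'} := by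
  induction l with
  | nil =>
    intro y _ _ k hk
    by_cases h : k ≤ 0
    · exact Submodule.subset_span
        ⟨[k], ⟨List.pairwise_singleton _ _, by simpa using h⟩, by simpa using hk, rfl,
          (word_cons k []).symm⟩
    · have : phi k (word []) = 0 := phi_vacuum (by omega)
      rw [this]
      exact Submodule.zero_mem _
  | cons x l ih =>
    intro y hl hy k hk
    obtain ⟨hp, hn⟩ := hl
    rw [List.pairwise_cons] at hp
    have hl' : Ordered l := ⟨hp.2, fun z hz => hn z (List.mem_cons_of_mem _ hz)⟩
    have hx0 : x ≤ 0 := hn x List.mem_cons_self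
    have hyx : y < x := hy x List.mem_cons_self
    have hc := LinearMap.congr_fun (phi_anticomm k x) (word l)
    rw [LinearMap.add_apply, Module.End.mul_apply, Module.End.mul_apply, LinearMap.smul_apply,
      Module.End.one_apply] at hc
    rcases lt_trichotomy k x with h | h | h
    · refine Submodule.subset_span ⟨k :: x :: l, ⟨?_, ?_⟩, ?_, rfl, (word_cons _ _).symm⟩
      · rw [List.pairwise_cons, List.pairwise_cons]
        refine ⟨?_, hp⟩
        intro z hz
        rcases List.mem_cons.mp hz with rfl | hz
        · exact h
        · exact h.trans (hp.1 z hz)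
      · intro z hz
        rcases List.mem_cons.mp hz with rfl | hz
        · omega
        · exact hn z hz
      · intro z hz
        rcases List.mem_cons.mp hz with rfl | hz
        · exact hk
        · exact hy z hz
    · subst h
      rw [neutralForm, if_neg (by omega), zero_smul, ← two_smul ℂ] at hc
      rw [word_cons, (smul_eq_zero.mp hc).resolve_left two_ne_zero]
      exact Submodule.zero_mem _
    · rw [word_cons, eq_sub_of_add_eq hc]
      refine Submodule.sub_mem _ ?_ ?_
      · unfold neutralForm
        split_ifs with hkx
        · rw [one_smul]
          refine Submodule.subset_span
            ⟨l, hl', fun z hz => hy z (List.mem_cons_of_mem _ hz), ?_, rfl⟩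
          rw [deg_cons, deg_cons]
          obtain rfl : k = 1 - x := by omega
          by_cases hx : Odd x
          · have : ¬ Odd (1 - x) := by
              rw [Int.not_odd_iff_even]
              exact odd_one.sub_odd hx
            simp [hx, this]
          · have : Odd (1 - x) := odd_one.sub_even (Int.not_odd_iff_even.mp hx)
            simp [hx, this]
        · rw [zero_smul]
          exact Submodule.zero_mem _
      · have hm := ih x hl' hp.1 k h
        generalize phi k (word l) = w at hm
        induction hm using Submodule.span_induction with
        | mem w hw =>
          obtain ⟨l', h1, h2, h3, rfl⟩ := hw
          refine Submodule.subset_span ⟨x :: l', ⟨?_, ?_⟩, ?_, ?_, (word_cons _ _).symm⟩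
          · exact List.pairwise_cons.mpr ⟨h2, h1.1⟩
          · intro z hz
            rcases List.mem_cons.mp hz with rfl | hz
            · exact hx0
            · exact h1.2 z hz
          · intro z hz
            rcases List.mem_cons.mp hz with rfl | hz
            · exact hyx
            · exact hyx.trans (h2 z hz)
          · rw [deg_cons, h3, deg_cons, deg_cons, deg_cons]
            ring
        | zero => rw [map_zero]; exact Submodule.zero_mem _
        | add v w _ _ hv hw => rw [map_add]; exact Submodule.add_mem _ hv hw
        | smul t v _ hv => rw [map_smul]; exact Submodule.smul_mem _ _ hv

theorem exists_lt (l : List ℤ) (k : ℤ) : ∃ y, y < k ∧ ∀ x ∈ l, y < x := by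
  induction l with
  | nil => exact ⟨k - 1, by omega, fun x hx => absurd hx List.not_mem_nil⟩
  | cons z l ih =>
    obtain ⟨y, h1, h2⟩ := ih
    refine ⟨min y (z - 1), lt_of_le_of_lt (min_le_left _ _) h1, fun x hx => ?_⟩
    rcases List.mem_cons.mp hx with rfl | hx
    · exact lt_of_le_of_lt (min_le_right _ _) (by omega)
    · exact lt_of_le_of_lt (min_le_left _ _) (h2 x hx)

theorem phi_mem {n : ℤ} {v : NeutralFock} (hv : v ∈ homog n) (k : ℤ) :
    phi k v ∈ homog (if Odd k then n + 1 else n - 1) := by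
  induction hv using Submodule.span_induction with
  | mem v h =>
    obtain ⟨l, hl, rfl, rfl⟩ := h
    obtain ⟨y, hk, hy⟩ := exists_lt l k
    refine Submodule.span_mono ?_ (phi_word l y hl hy k hk)
    rintro v ⟨l', h1, -, h3, rfl⟩
    refine ⟨l', h1, ?_, rfl⟩
    rw [h3, deg_cons]
    split_ifs <;> ring
  | zero => rw [map_zero]; exact Submodule.zero_mem _
  | add v w _ _ hv hw => rw [map_add]; exact Submodule.add_mem _ hv hw
  | smul t v _ hv => rw [map_smul]; exact Submodule.smul_mem _ _ hv

theorem nop_mem {n : ℤ} {v : NeutralFock} (hv : v ∈ homog n) (i j : ℤ) :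
    pair.nop i j v ∈ homog n := by
  have hi : Odd (-2 * i + 1) := ⟨-i, by ring⟩
  have hj : ¬ Odd (2 * j) := by
    rw [Int.not_odd_iff_even]
    exact ⟨j, by ring⟩
  unfold FermionPair.nop
  split_ifs
  · have h := phi_mem (phi_mem hv (-2 * i + 1)) (2 * j)
    rw [if_pos hi, if_neg hj, add_sub_cancel_right] at h
    exact Submodule.neg_mem _ h
  · have h := phi_mem (phi_mem hv (2 * j)) (-2 * i + 1)
    rw [if_pos hi, if_neg hj, sub_add_cancel] at h
    exact h

/-- The degree component `F_{(n)}` as a submodule for `r_1`. -/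
def component (n : ℤ) : LieSubmodule ℂ AInf NeutralFock where
  __ := homog n
  lie_mem := by
    intro x v hv
    obtain ⟨M, hM⟩ := (pair.act_eventually (AInf.mat x) v).exists
    rw [lie_eq, hM]
    exact Submodule.add_mem _ (Submodule.sum_mem _ fun i _ => Submodule.sum_mem _ fun j _ =>
      Submodule.smul_mem _ _ (nop_mem hv i j)) (Submodule.smul_mem _ _ hv)

end NeutralFock

/-! ### The Fock space of a pair of charged fermions -/

/-- `{ψ^+_m, ψ^-_n} = δ_{m + n, -1}`, `{ψ^±_m, ψ^±_n} = 0`; here `Sum.inl n` stands for `ψ^+_n` and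
`Sum.inr n` for `ψ^-_n`. -/
def chargedForm : ℤ ⊕ ℤ → ℤ ⊕ ℤ → ℂ
  | .inl m, .inr n => if m + n = -1 then 1 else 0
  | .inr m, .inl n => if m + n = -1 then 1 else 0
  | .inl _, .inl _ => 0
  | .inr _, .inr _ => 0

/-- The modes `ψ^±_n` with `n ≥ 0`, which annihilate the vacuum. -/
def chargedPos : Set (ℤ ⊕ ℤ) := {x | 0 ≤ Sum.elim id id x}

/-- The Fock space `F^{⊗ 1}` of a pair of charged free fermions. -/
def ChargedFock : Type := Fock chargedForm chargedPos

namespace ChargedFock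

instance : AddCommGroup ChargedFock := inferInstanceAs (AddCommGroup (Fock _ _))

instance : Module ℂ ChargedFock := inferInstanceAs (Module ℂ (Fock _ _))

/-- The operators `ψ^+_n`. -/
def psiPlus (n : ℤ) : Module.End ℂ ChargedFock := op chargedForm chargedPos (.inl n)

/-- The operators `ψ^-_n`. -/
def psiMinus (n : ℤ) : Module.End ℂ ChargedFock := op chargedForm chargedPos (.inr n)

/-- The operators `a_i = ψ^+_{-i}` and `b_j = ψ^-_{j - 1}`, the coefficients of `z^{i - 1}` in `ψ^+(z)`
and of `w^{-j}` in `ψ^-(w)`. -/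
def pair : FermionPair ChargedFock :=
  Fock.pair (β := chargedForm) (P := chargedPos)
    (fun x y => by
      rcases x with m | m <;> rcases y with n | n <;> simp [chargedForm, add_comm])
    (fun i => .inl (-i)) (fun j => .inr (j - 1))
    (fun i j => if_congr (by omega) rfl rfl)
    (fun i j => rfl) (fun i j => rfl)
    (fun i hi => by change 0 ≤ -i; omega)
    (fun j hj => by change 0 ≤ j - 1; omega)
    (fun x => by
      rcases x with m | m
      · exact Or.inl ⟨-m, by rw [neg_neg]⟩
      · exact Or.inr ⟨m + 1, by rw [add_sub_cancel_right]⟩)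

theorem pair_a (i : ℤ) : pair.a i = psiPlus (-i) := rfl

theorem pair_b (j : ℤ) : pair.b j = psiMinus (j - 1) := rfl

/-- The standard representation of `a_∞`, `∑ E_{ij} z^{i-1} w^{-j} ↦ :ψ^+(z) ψ^-(w):`, `c ↦ 1`. -/
instance : LieRingModule AInf ChargedFock := pair.lieRingModule

instance : LieModule ℂ AInf ChargedFock := pair.lieModule

theorem lie_eq (x : AInf) (v : ChargedFock) :
    ⁅x, v⁆ = pair.act (AInf.mat x) v + AInf.cen x • v := rfl

end ChargedFock

end

end FermionFock

/-!
Both Fock spaces are instances of one picture: fermionic operators `a_i`, `b_j` with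
`{a_i, b_j} = δ_{ij}`, in which `E_{ij}` acts by the normally ordered product `:a_i b_j:`. A vector
killed by `a_i` for `i ≤ n` and by `b_i` for `i > n` has the levels `i ≤ n` filled and the others
empty; it is a highest weight vector of weight `weightHat n`, and it is unique up to scalars as soon
as the vacuum is.

Let `N` be a subspace stable under all `:a_i b_j:`. The products `a_i b_i` and `b_i a_i` are
complementary projections, so `N` is spanned by vectors for which every level is either filled or
empty. Such a vector differs from a filled sea in finitely many levels, and moving one particle at a
time by the operators `a_i b_j`, which can be undone by `a_j b_i`, turns it into a filled sea within
`N`. Hence `N` contains every vector of charge `n` as soon as it contains a nonzero one: the charge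
spaces are irreducible. The charge is the eigenvalue of the identity matrix, and the charge spaces
of the neutral Fock space are the spans `F_{(n)}` of monomials.

The vacuum of the neutral Fock space is unique up to scalars because the diagonal matrix with
entries `2i - 1/2` kills all vacuum vectors and gives all creation operators positive energy. An
irreducible module with a highest weight vector of weight `Λ` is a simple quotient of the Verma
module, which has a unique maximal submodule since the highest weight space is a line. Finally, the
charged Fock space is the neutral one with relabelled generators.
-/

namespace FermionFock

open Filter

noncomputable section

/-! ### Eigenspaces -/

section Eigenspace

open Module.End

variable {K V : Type*} [Field K] [AddCommGroup V] [Module K V] {f : Module.End K V} {μ : K}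

theorem mem_of_add_mem_of_mem_eigenspace {N : Submodule K V} (hN : N ≤ N.comap f) {x y : V}
    (hx : x ∈ eigenspace f μ) (hy : y ∈ ⨆ ν ≠ μ, eigenspace f ν) (hxy : x + y ∈ N) : x ∈ N := by
  set g : Module.End K (V ⧸ N) := N.mapQ N f hN
  have hmap (ν : K) : (eigenspace f ν).map N.mkQ ≤ eigenspace g ν := by
    rintro _ ⟨w, hw, rfl⟩
    rw [mem_eigenspace_iff, Submodule.mkQ_apply, Submodule.mapQ_apply, mem_eigenspace_iff.mp hw,
      Submodule.Quotient.mk_smul]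
  have hy' : N.mkQ y ∈ ⨆ ν ≠ μ, eigenspace g ν := by
    have := Submodule.mem_map_of_mem (f := N.mkQ) hy
    simp only [Submodule.map_iSup] at this
    exact iSup₂_mono (fun ν _ => hmap ν) this
  have hxy' : N.mkQ x = -N.mkQ y := by
    rw [eq_neg_iff_add_eq_zero, ← map_add]
    exact (Submodule.Quotient.mk_eq_zero N).mpr hxy
  refine (Submodule.Quotient.mk_eq_zero N).mp ?_
  change N.mkQ x = 0
  exact Submodule.disjoint_def.mp (eigenspaces_iSupIndep g μ) _
    (hmap μ (Submodule.mem_map_of_mem hx)) (hxy' ▸ neg_mem hy')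

theorem eigenspace_le_of_sup_eq_top {W : Submodule K V} (hW : W ≤ eigenspace f μ)
    (h : W ⊔ ⨆ ν ≠ μ, eigenspace f ν = ⊤) : eigenspace f μ ≤ W := by
  rw [← top_inf_eq (eigenspace f μ), ← h, sup_inf_assoc_of_le _ hW,
    (eigenspaces_iSupIndep f μ).symm.eq_bot, sup_bot_eq]

end Eigenspace

/-! ### Direct sums of Lie modules -/

section DirectSum

variable {R L M I : Type*} {M' M'' : I → Type*} [CommRing R] [LieRing L]
  [AddCommGroup M] [Module R M] [LieRingModule L M]
  [∀ i, AddCommGroup (M' i)] [∀ i, Module R (M' i)] [∀ i, LieRingModule L (M' i)]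
  [∀ i, AddCommGroup (M'' i)] [∀ i, Module R (M'' i)] [∀ i, LieRingModule L (M'' i)]

/-- The isomorphism of direct sums of Lie modules induced by isomorphisms of the summands. -/
def directSumLieEquivCongr (e : ∀ i, M' i ≃ₗ⁅R,L⁆ M'' i) :
    DirectSum I M' ≃ₗ⁅R,L⁆ DirectSum I M'' :=
  { DirectSum.congrLinearEquiv fun i => (e i).toLinearEquiv with
    map_lie' := fun {x w} => DFinsupp.ext fun i => (e i).toLieModuleHom.map_lie x (w i) }

variable [DecidableEq I]

theorem toModule_lie (f : ∀ i, M' i →ₗ⁅R,L⁆ M)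
    (x : L) (w : DirectSum I M') :
    DirectSum.toModule R I M (fun i => (f i : M' i →ₗ[R] M)) ⁅x, w⁆ =
      ⁅x, DirectSum.toModule R I M (fun i => (f i : M' i →ₗ[R] M)) w⁆ := by
  induction w using DirectSum.induction_on with
  | zero => rw [lie_zero, map_zero, lie_zero]
  | of i w =>
    have h : ⁅x, DirectSum.lof R I M' i w⁆ = DirectSum.lof R I M' i ⁅x, w⁆ :=
      ((DirectSum.lieModuleOf R I L M' i).map_lie x w).symm
    rw [← DirectSum.lof_eq_of R, h, DirectSum.toModule_lof, DirectSum.toModule_lof]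
    exact (f i).map_lie x w
  | add v w hv hw => rw [lie_add, map_add, map_add, lie_add, hv, hw]

/-- The decomposition of a Lie module given by an internal direct sum of submodules. -/
def directSumLieEquivOfIsInternal {N : I → LieSubmodule R L M}
    (hN : DirectSum.IsInternal fun i => (N i).toSubmodule) :
    DirectSum I (fun i => N i) ≃ₗ⁅R,L⁆ M :=
  { LinearEquiv.ofBijective (DirectSum.coeLinearMap fun i => (N i).toSubmodule) hN with
    map_lie' := fun {x w} => toModule_lie (fun i => (N i).incl) x w }

end DirectSum

/-! ### Modules over enveloping algebras -/

open UniversalEnvelopingAlgebra (ι)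

local notation "𝒰" => UniversalEnvelopingAlgebra

section Enveloping

open Module.End

variable {R L : Type*} [CommRing R] [LieRing L] [LieAlgebra R L]

theorem ι_mul_ι (x y : L) : ι R x * ι R y = ι R ⁅x, y⁆ + ι R y * ι R x := by
  let _ : LieRing (𝒰 R L) := LieRing.ofAssociativeRing
  rw [LieHom.map_lie, LieRing.of_associative_ring_bracket, sub_add_cancel]

theorem adjoin_range_ι : Algebra.adjoin R (Set.range (ι R : L → 𝒰 R L)) = ⊤ := by
  set S := Algebra.adjoin R (Set.range (ι R : L → 𝒰 R L))
  let _ : LieRing (𝒰 R L) := LieRing.ofAssociativeRing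
  let _ : LieRing S := LieRing.ofAssociativeRing
  let _ : LieAlgebra R S := LieAlgebra.ofAssociativeAlgebra
  let j : L →ₗ⁅R⁆ S :=
    { (ι R : L →ₗ⁅R⁆ 𝒰 R L).toLinearMap.codRestrict (Subalgebra.toSubmodule S)
        fun x => Algebra.subset_adjoin ⟨x, rfl⟩ with
      map_lie' := fun {x y} => Subtype.ext (LieHom.map_lie (ι R) x y) }
  have hj : S.val.comp (UniversalEnvelopingAlgebra.lift R j) = AlgHom.id R (𝒰 R L) := by
    refine UniversalEnvelopingAlgebra.hom_ext R (LieHom.ext fun x => ?_)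
    exact congrArg Subtype.val (UniversalEnvelopingAlgebra.lift_ι_apply R j x)
  refine eq_top_iff.mpr fun u _ => ?_
  rw [← AlgHom.id_apply (R := R) u, ← hj]
  exact (UniversalEnvelopingAlgebra.lift R j u).2

variable {V : Type*} [AddCommGroup V] [Module R V] [Module (𝒰 R L) V] [IsScalarTower R (𝒰 R L) V]

theorem smul_mem_of_forall_ι_smul_mem {W : Submodule R V} (hW : ∀ x : L, ∀ w ∈ W, ι R x • w ∈ W)
    (u : 𝒰 R L) : ∀ w ∈ W, u • w ∈ W := by
  have hu : u ∈ Algebra.adjoin R (Set.range (ι R : L → 𝒰 R L)) := by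
    rw [adjoin_range_ι]
    exact Algebra.mem_top
  induction hu using Algebra.adjoin_induction with
  | mem _ hx =>
    obtain ⟨x, rfl⟩ := hx
    exact hW x
  | algebraMap r =>
    intro w hw
    rw [algebraMap_smul]
    exact W.smul_mem r hw
  | add u u' _ _ hu hu' =>
    intro w hw
    rw [add_smul]
    exact W.add_mem (hu w hw) (hu' w hw)
  | mul u u' _ _ hu hu' =>
    intro w hw
    rw [mul_smul]
    exact hu _ (hu' w hw)

/-- A weak form of the Poincaré–Birkhoff–Witt theorem: if `L` is spanned by `Y` and elements
preserving the line of `v`, then `U(L) v` is spanned by monomials in `Y` applied to `v`. -/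
theorem smul_mem_of_forall_mem_smul_mem {Y : Set L} {v : V}
    (hY : ∀ x : L, ∃ y ∈ Submodule.span R Y, ι R (x - y) • v ∈ R ∙ v) {W : Submodule R V}
    (hv : v ∈ W) (hW : ∀ y ∈ Y, ∀ w ∈ W, ι R y • w ∈ W) (u : 𝒰 R L) : u • v ∈ W := by
  let stable : Set (Submodule R V) := {W | v ∈ W ∧ ∀ y ∈ Y, ∀ w ∈ W, ι R y • w ∈ W}
  set W₀ := sInf stable
  have hv₀ : v ∈ W₀ := Submodule.mem_sInf.mpr fun W hW => hW.1
  have hY₀ (y) (hy : y ∈ Y) (w) (hw : w ∈ W₀) : ι R y • w ∈ W₀ :=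
    Submodule.mem_sInf.mpr fun W hW => hW.2 y hy w (Submodule.mem_sInf.mp hw W hW)
  have hspan (y) (hy : y ∈ Submodule.span R Y) : ι R y • v ∈ W₀ := by
    induction hy using Submodule.span_induction with
    | mem y hy => exact hY₀ y hy v hv₀
    | zero => rw [map_zero, zero_smul]; exact W₀.zero_mem
    | add y y' _ _ hy hy' => rw [map_add, add_smul]; exact W₀.add_mem hy hy'
    | smul r y _ hy => rw [map_smul, smul_assoc]; exact W₀.smul_mem r hy
  have hx₀ (x : L) : ι R x • v ∈ W₀ := by
    obtain ⟨y, hy, hxy⟩ := hY x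
    rw [← sub_add_cancel x y, map_add, add_smul]
    exact W₀.add_mem ((Submodule.span_singleton_le_iff_mem _ _).mpr hv₀ hxy) (hspan y hy)
  let P : Submodule R V := W₀ ⊓ ⨅ x : L, W₀.comap (Algebra.lsmul R R V (ι R x))
  have mem_P {w : V} : w ∈ P ↔ w ∈ W₀ ∧ ∀ x : L, ι R x • w ∈ W₀ := by
    rw [Submodule.mem_inf, Submodule.mem_iInf]
    rfl
  have hP : W₀ ≤ P := sInf_le ⟨mem_P.mpr ⟨hv₀, hx₀⟩, fun y hy w hw => mem_P.mpr
    ⟨hY₀ y hy w (mem_P.mp hw).1, fun x => by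
      rw [← mul_smul, ι_mul_ι, add_smul, mul_smul]
      exact W₀.add_mem ((mem_P.mp hw).2 _) (hY₀ y hy _ ((mem_P.mp hw).2 x))⟩⟩
  exact (sInf_le (show W ∈ stable from ⟨hv, hW⟩) : W₀ ≤ W)
    (smul_mem_of_forall_ι_smul_mem (fun x w hw => (mem_P.mp (hP hw)).2 x) u v hv₀)

theorem ι_smul_mem_eigenspace {p y : L} {c ν : R} (hy : ⁅p, y⁆ = c • y) {w : V}
    (hw : w ∈ eigenspace (Algebra.lsmul R R V (ι R p)) ν) :
    ι R y • w ∈ eigenspace (Algebra.lsmul R R V (ι R p)) (ν + c) := by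
  have hpw : ι R p • w = ν • w := mem_eigenspace_iff.mp hw
  rw [mem_eigenspace_iff]
  change ι R p • ι R y • w = (ν + c) • ι R y • w
  rw [← mul_smul, ι_mul_ι, hy, add_smul, mul_smul, hpw, smul_comm, map_smul, smul_assoc,
    ← add_smul, add_comm]

end Enveloping

section HighestWeight

open Module.End

variable {K L V : Type*} [Field K] [LieRing L] [LieAlgebra K L]

variable (K) in
/-- The elements of `L` of positive integral degree in the grading defined by `ad p`. -/
def posDegree (p : L) : Set L := {y | ∃ d : ℕ, ⁅p, y⁆ = ((d + 1 : ℕ) : K) • y}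

variable [CharZero K] [AddCommGroup V] [Module K V] [Module (𝒰 K L) V] [IsScalarTower K (𝒰 K L) V]
  {p : L} {v : V} {μ : K}

theorem smul_mem_span_sup_iSup_eigenspace (hp : ι K p • v = μ • v)
    (hL : ∀ x : L, ∃ y ∈ Submodule.span K (posDegree K p), ι K (x - y) • v ∈ K ∙ v) (u : 𝒰 K L) :
    u • v ∈ K ∙ v ⊔ ⨆ ν ≠ μ, eigenspace (Algebra.lsmul K K V (ι K p)) ν := by
  set f := Algebra.lsmul K K V (ι K p)
  let W := K ∙ v ⊔ ⨆ e : ℕ, eigenspace f (μ + (e + 1 : ℕ))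
  have hW : W ≤ K ∙ v ⊔ ⨆ ν ≠ μ, eigenspace f ν := by
    refine sup_le_sup_left (iSup_le fun e => ?_) _
    exact le_iSup₂_of_le (μ + (e + 1 : ℕ)) (by simpa using Nat.cast_add_one_ne_zero e) le_rfl
  refine hW (smul_mem_of_forall_mem_smul_mem hL
    (Submodule.mem_sup_left (Submodule.mem_span_singleton_self v)) ?_ u)
  rintro y ⟨d, hy⟩
  change W ≤ W.comap (Algebra.lsmul K K V (ι K y))
  refine sup_le ((Submodule.span_singleton_le_iff_mem _ _).mpr ?_) (iSup_le fun e w hw => ?_)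
  · exact Submodule.mem_sup_right (Submodule.mem_iSup_of_mem d
      (ι_smul_mem_eigenspace hy (mem_eigenspace_iff.mpr hp)))
  · refine Submodule.mem_sup_right (Submodule.mem_iSup_of_mem (e + 1 + d) ?_)
    have := ι_smul_mem_eigenspace hy hw
    rwa [add_assoc, ← Nat.cast_add, ← add_assoc] at this

theorem sSup_ne_top_ne_top (hp : ι K p • v = μ • v)
    (hL : ∀ x : L, ∃ y ∈ Submodule.span K (posDegree K p), ι K (x - y) • v ∈ K ∙ v)
    (hv : Submodule.span (𝒰 K L) {v} = ⊤) (hv0 : v ≠ 0) :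
    sSup {N : Submodule (𝒰 K L) V | N ≠ ⊤} ≠ ⊤ := by
  set f := Algebra.lsmul K K V (ι K p)
  have hvμ : v ∈ eigenspace f μ := mem_eigenspace_iff.mpr hp
  have hproper (N : Submodule (𝒰 K L) V) (hN : N ≠ ⊤) (x : V) (hx : x ∈ N) :
      x ∈ ⨆ ν ≠ μ, eigenspace f ν := by
    obtain ⟨u, rfl⟩ := Submodule.mem_span_singleton.mp (hv ▸ Submodule.mem_top : x ∈ _)
    obtain ⟨w, hw, y, hy, hwy⟩ := Submodule.mem_sup.mp (smul_mem_span_sup_iSup_eigenspace hp hL u)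
    obtain ⟨t, rfl⟩ := Submodule.mem_span_singleton.mp hw
    have htv : t • v ∈ N := mem_of_add_mem_of_mem_eigenspace (N := N.restrictScalars K)
      (fun _ => N.smul_mem _) (Submodule.smul_mem _ t hvμ) hy (hwy ▸ hx)
    have ht : t = 0 := by
      by_contra ht
      refine hN (top_le_iff.mp (hv ▸ (Submodule.span_singleton_le_iff_mem v N).mpr ?_))
      exact (N.restrictScalars K).smul_mem_iff ht |>.mp htv
    rwa [← hwy, ht, zero_smul, zero_add]
  intro htop
  have hmem : v ∈ ⨆ ν ≠ μ, eigenspace f ν := by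
    have h : v ∈ (⊤ : Submodule (𝒰 K L) V) := Submodule.mem_top
    rw [← htop, sSup_eq_iSup'] at h
    exact Submodule.iSup_induction _ (motive := (· ∈ ⨆ ν ≠ μ, eigenspace f ν)) h
      (fun N => hproper N N.2) (zero_mem _) fun _ _ => add_mem
  exact hv0 (Submodule.disjoint_def.mp (eigenspaces_iSupIndep f μ) v hvμ hmem)

end HighestWeight

section LieModule

variable {R L M : Type*} [CommRing R] [LieRing L] [LieAlgebra R L] [AddCommGroup M] [Module R M]
  [LieRingModule L M]

section

variable [Module (𝒰 R L) M] [IsScalarTower R (𝒰 R L) M]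

theorem isSimpleModule_of_isIrreducible [LieModule.IsIrreducible R L M]
    (hι : ∀ (x : L) (w : M), ι R x • w = ⁅x, w⁆) : IsSimpleModule (𝒰 R L) M := by
  have : Nontrivial M := (LieSubmodule.nontrivial_iff R L M).mp inferInstance
  rw [isSimpleModule_iff]
  refine { exists_pair_ne := exists_pair_ne _, eq_bot_or_eq_top := fun N => ?_ }
  let N' : LieSubmodule R L M :=
    { N.restrictScalars R with lie_mem := fun {x w} hw => hι x w ▸ N.smul_mem _ hw }
  refine (eq_bot_or_eq_top N').imp (fun h => ?_) fun h => ?_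
  · exact (Submodule.eq_bot_iff N).mpr ((LieSubmodule.eq_bot_iff N').mp h)
  · exact eq_top_iff.mpr fun w _ => (h ▸ LieSubmodule.mem_top w : w ∈ N')

/-- A `U(L)`-linear equivalence, as an equivalence of Lie modules. -/
def lieModuleEquivOfLinearEquiv {M' : Type*} [AddCommGroup M'] [Module R M'] [LieRingModule L M']
    [Module (𝒰 R L) M'] [IsScalarTower R (𝒰 R L) M']
    (hι : ∀ (x : L) (w : M), ι R x • w = ⁅x, w⁆) (hι' : ∀ (x : L) (w : M'), ι R x • w = ⁅x, w⁆)
    (e : M ≃ₗ[𝒰 R L] M') : M ≃ₗ⁅R,L⁆ M' :=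
  { e.restrictScalars R with
    map_lie' := fun {x w} => by
      change e ⁅x, w⁆ = ⁅x, e w⁆
      rw [← hι, ← hι', map_smul] }

end

variable [LieModule R L M]

variable (R L M) in
/-- The `U(L)`-module structure on a Lie module. -/
@[reducible] def envelopingModule : Module (𝒰 R L) M :=
  Module.compHom M (UniversalEnvelopingAlgebra.lift R (LieModule.toEnd R L M)).toRingHom

theorem envelopingModule_ι_smul (x : L) (w : M) :
    letI := envelopingModule R L M
    ι R x • w = ⁅x, w⁆ := by
  change UniversalEnvelopingAlgebra.lift R (LieModule.toEnd R L M) (ι R x) w = _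
  rw [UniversalEnvelopingAlgebra.lift_ι_apply, LieModule.toEnd_apply_apply]

variable (R L M) in
theorem envelopingModule_isScalarTower :
    letI := envelopingModule R L M
    IsScalarTower R (𝒰 R L) M := by
  let _ := envelopingModule R L M
  exact ⟨fun r u w => LinearMap.congr_fun (map_smul
    (UniversalEnvelopingAlgebra.lift R (LieModule.toEnd R L M)) r u) w⟩

end LieModule

/-! ### Highest weight modules of `a_∞` -/

/-- The diagonal matrix `diag(d_i)`. -/
def diagBand (d : ℤ → ℂ) : Band :=
  ⟨Matrix.diagonal d, 0, fun i j h => Matrix.diagonal_apply_ne _ fun hij => by simp [hij] at h⟩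

theorem diagBand_apply_ne (d : ℤ → ℂ) {i j : ℤ} (h : i ≠ j) : (diagBand d).1 i j = 0 :=
  Matrix.diagonal_apply_ne _ h

theorem diagBand_apply_self (d : ℤ → ℂ) (i : ℤ) : (diagBand d).1 i i = d i :=
  Matrix.diagonal_apply_eq _ i

theorem diagBand_mul_apply (d : ℤ → ℂ) (A : Band) (i j : ℤ) :
    (diagBand d * A).1 i j = d i * A.1 i j := by
  rw [Band.mul_apply_eq _ A i j {i} fun k hk => by
      rw [diagBand_apply_ne d (Ne.symm (by simpa using hk)), zero_mul],
    Finset.sum_singleton, diagBand_apply_self]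

theorem mul_diagBand_apply (d : ℤ → ℂ) (A : Band) (i j : ℤ) :
    (A * diagBand d).1 i j = A.1 i j * d j := by
  rw [Band.mul_apply_eq A _ i j {j} fun k hk => by
      rw [diagBand_apply_ne d (by simpa using hk), mul_zero],
    Finset.sum_singleton, diagBand_apply_self]

theorem cocycle_diagBand (d : ℤ → ℂ) (A : Band) : cocycle (diagBand d) A = 0 := by
  obtain ⟨M, hM⟩ := (cocycle_eventually (diagBand d)).exists
  rw [hM]
  refine Finset.sum_eq_zero fun i _ => Finset.sum_eq_zero fun j _ => ?_
  obtain rfl | h := eq_or_ne i j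
  · rw [sub_self, zero_mul, zero_mul]
  · rw [diagBand_apply_ne d h, mul_zero, zero_mul]

/-- The element `diag(i)`, which defines the principal gradation. -/
def principal : AInf := AInf.ofMat (diagBand fun i => (i : ℂ))

theorem principal_mem_cartan : principal ∈ cartan := fun _ _ h => diagBand_apply_ne _ h

theorem principal_lie_ofMat {A : Band} {d : ℤ} (hA : ∀ i j, i - j ≠ d → A.1 i j = 0) :
    ⁅principal, AInf.ofMat A⁆ = (d : ℂ) • AInf.ofMat A := by
  refine AInf.ext' (Band.ext' fun i j => ?_) ((cocycle_diagBand _ A).trans (mul_zero _).symm)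
  change (diagBand _ * A).1 i j - (A * diagBand _).1 i j = (d : ℂ) * A.1 i j
  rw [diagBand_mul_apply, mul_diagBand_apply]
  by_cases h : i - j = d
  · rw [← h, Int.cast_sub]
    ring
  · rw [hA i j h]
    ring

/-- The part of a band matrix supported on the diagonals `i - j ∈ s`. -/
def bandPart (s : Set ℤ) (A : Band) : Band :=
  ⟨fun i j => s.indicator (fun _ => A.1 i j) (i - j), by
    obtain ⟨N, hN⟩ := A.2
    exact ⟨N, fun i j h => Set.indicator_apply_eq_zero.mpr fun _ => hN i j h⟩⟩

theorem bandPart_apply_of_mem {s : Set ℤ} (A : Band) {i j : ℤ} (h : i - j ∈ s) :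
    (bandPart s A).1 i j = A.1 i j := Set.indicator_of_mem h fun _ => A.1 i j

theorem bandPart_apply_of_notMem {s : Set ℤ} (A : Band) {i j : ℤ} (h : i - j ∉ s) :
    (bandPart s A).1 i j = 0 := Set.indicator_of_notMem h fun _ => A.1 i j

theorem bandPart_apply_eq_zero {s : Set ℤ} {A : Band} {i j : ℤ} (h : i - j ∈ s → A.1 i j = 0) :
    (bandPart s A).1 i j = 0 := by
  by_cases hs : i - j ∈ s
  · rw [bandPart_apply_of_mem A hs, h hs]
  · exact bandPart_apply_of_notMem A hs

theorem ofMat_bandPart_Iio_mem_upper (A : Band) :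
    AInf.ofMat (bandPart (Set.Iio 0) A) ∈ upper :=
  ⟨rfl, fun _ _ hij => bandPart_apply_of_notMem A (Set.notMem_Iio.mpr (sub_nonneg.mpr hij))⟩

theorem bandPart_Ioi_eq_sum (A : Band) :
    ∃ N : ℕ, bandPart (Set.Ioi 0) A = ∑ d ∈ Finset.range N, bandPart {((d + 1 : ℕ) : ℤ)} A := by
  obtain ⟨N, hN⟩ := A.width
  refine ⟨N, Band.ext' fun i j => ?_⟩
  rw [Submodule.coe_sum, Matrix.sum_apply]
  by_cases h : 0 < i - j ∧ i - j ≤ N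
  · rw [Finset.sum_eq_single_of_mem (i - j - 1).toNat (Finset.mem_range.mpr (by omega)),
      bandPart_apply_of_mem A (Set.mem_Ioi.mpr h.1), bandPart_apply_of_mem A]
    · rw [Set.mem_singleton_iff]
      omega
    · refine fun d _ hd => bandPart_apply_of_notMem A fun hc => hd ?_
      rw [Set.mem_singleton_iff] at hc
      omega
  · have hout : i - j ∈ Set.Ioi 0 → A.1 i j = 0 := fun hpos =>
      hN i j ((not_le.mp fun hle => h ⟨hpos, hle⟩).trans_le (le_abs_self _))
    rw [bandPart_apply_eq_zero hout, Finset.sum_eq_zero]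
    refine fun d _ => bandPart_apply_eq_zero fun hd => hout ?_
    rw [Set.mem_singleton_iff.mp hd]
    exact Int.natCast_pos.mpr d.succ_pos

theorem ofMat_bandPart_Ioi_mem_span (A : Band) :
    AInf.ofMat (bandPart (Set.Ioi 0) A) ∈ Submodule.span ℂ (posDegree ℂ principal) := by
  obtain ⟨N, hN⟩ := bandPart_Ioi_eq_sum A
  rw [hN, map_sum]
  refine Submodule.sum_mem _ fun d _ => Submodule.subset_span ⟨d, ?_⟩
  rw [← Int.cast_natCast]
  exact principal_lie_ofMat fun i j hij => bandPart_apply_of_notMem A hij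

theorem exists_triangular (x : AInf) : ∃ u ∈ upper, ∃ h ∈ cartan,
    ∃ y ∈ Submodule.span ℂ (posDegree ℂ principal), x = u + h + y := by
  set A := AInf.mat x
  set u := AInf.ofMat (bandPart (Set.Iio 0) A)
  set y := AInf.ofMat (bandPart (Set.Ioi 0) A)
  refine ⟨u, ofMat_bandPart_Iio_mem_upper A, x - u - y, fun i j hij => ?_, y,
    ofMat_bandPart_Ioi_mem_span A, by abel⟩
  change A.1 i j - (bandPart (Set.Iio 0) A).1 i j - (bandPart (Set.Ioi 0) A).1 i j = 0
  obtain h | h := lt_or_gt_of_ne (sub_ne_zero.mpr hij)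
  · rw [bandPart_apply_of_mem A (Set.mem_Iio.mpr h),
      bandPart_apply_of_notMem A (Set.notMem_Ioi.mpr h.le), sub_self, sub_zero]
  · rw [bandPart_apply_of_notMem A (Set.notMem_Iio.mpr h.le),
      bandPart_apply_of_mem A (Set.mem_Ioi.mpr h),
      sub_zero, sub_self]

section Verma

variable (Λ : Module.Dual ℂ cartan)

/-- The canonical highest weight vector of the Verma module. -/
def vermaVec : Verma Λ := Submodule.Quotient.mk 1

theorem smul_vermaVec (u : UAInf) : u • vermaVec Λ = Submodule.Quotient.mk u := by
  rw [vermaVec, ← Submodule.Quotient.mk_smul, smul_eq_mul, mul_one]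

theorem ι_smul_vermaVec_of_mem_upper {x : AInf} (hx : x ∈ upper) : ι ℂ x • vermaVec Λ = 0 := by
  rw [smul_vermaVec, Submodule.Quotient.mk_eq_zero]
  exact Submodule.subset_span (Or.inl ⟨x, hx, rfl⟩)

theorem ι_smul_vermaVec_of_cartan (h : cartan) : ι ℂ h.1 • vermaVec Λ = Λ h • vermaVec Λ := by
  rw [← algebraMap_smul UAInf (Λ h), ← sub_eq_zero, ← sub_smul, smul_vermaVec,
    Submodule.Quotient.mk_eq_zero]
  exact Submodule.subset_span (Or.inr ⟨h, rfl⟩)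

theorem span_vermaVec : Submodule.span UAInf {vermaVec Λ} = ⊤ := by
  refine eq_top_iff.mpr fun w _ => ?_
  obtain ⟨u, rfl⟩ := Submodule.Quotient.mk_surjective _ w
  exact Submodule.mem_span_singleton.mpr ⟨u, smul_vermaVec Λ u⟩

theorem sSup_ne_top_ne_top_verma (h0 : vermaVec Λ ≠ 0) :
    sSup {N : Submodule UAInf (Verma Λ) | N ≠ ⊤} ≠ ⊤ := by
  refine sSup_ne_top_ne_top (ι_smul_vermaVec_of_cartan Λ ⟨principal, principal_mem_cartan⟩)
    (fun x => ?_) (span_vermaVec Λ) h0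
  obtain ⟨u, hu, h, hh, y, hy, rfl⟩ := exists_triangular x
  refine ⟨y, hy, Submodule.mem_span_singleton.mpr ⟨Λ ⟨h, hh⟩, ?_⟩⟩
  rw [add_sub_cancel_right, map_add, add_smul, ι_smul_vermaVec_of_mem_upper Λ hu, zero_add,
    ι_smul_vermaVec_of_cartan Λ ⟨h, hh⟩]

end Verma

section HighestWeightVector

variable {M : Type*} [AddCommGroup M] [Module ℂ M] [LieRingModule AInf M]

/-- A nonzero vector `v` with `a_∞^+ v = 0` on which `a_∞^0` acts through the weight `Λ`. -/
structure IsHighestWeightVector (Λ : Module.Dual ℂ cartan) (v : M) : Prop where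
  ne_zero : v ≠ 0
  upper_lie : ∀ x ∈ upper, ⁅x, v⁆ = 0
  cartan_lie : ∀ h : cartan, ⁅h.1, v⁆ = Λ h • v

namespace IsHighestWeightVector

section

variable [Module UAInf M] [IsScalarTower ℂ UAInf M] {Λ : Module.Dual ℂ cartan} {v : M}

theorem vermaIdeal_le_ker (hι : ∀ (x : AInf) (w : M), ι ℂ x • w = ⁅x, w⁆)
    (hv : IsHighestWeightVector Λ v) :
    vermaIdeal Λ ≤ LinearMap.ker (LinearMap.toSpanSingleton UAInf M v) := by
  refine Submodule.span_le.mpr ?_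
  rintro u (⟨x, hx, rfl⟩ | ⟨h, rfl⟩)
  · exact (hι x v).trans (hv.upper_lie x hx)
  · change (ι ℂ h.1 - algebraMap ℂ UAInf (Λ h)) • v = 0
    rw [sub_smul, hι, algebraMap_smul, hv.cartan_lie, sub_self]

variable (hι : ∀ (x : AInf) (w : M), ι ℂ x • w = ⁅x, w⁆) (hv : IsHighestWeightVector Λ v)

/-- The homomorphism from the Verma module that sends its highest weight vector to `v`. -/
def vermaLift : Verma Λ →ₗ[UAInf] M :=
  (vermaIdeal Λ).liftQ (LinearMap.toSpanSingleton UAInf M v) (hv.vermaIdeal_le_ker hι)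

theorem vermaLift_vermaVec : hv.vermaLift hι (vermaVec Λ) = v := one_smul UAInf v

theorem vermaLift_surjective [IsSimpleModule UAInf M] :
    Function.Surjective (hv.vermaLift hι) :=
  LinearMap.surjective_of_ne_zero fun h => hv.ne_zero <| by
    rw [← hv.vermaLift_vermaVec hι, h, LinearMap.zero_apply]

theorem sSup_ne_top_eq_ker_vermaLift [IsSimpleModule UAInf M] :
    sSup {N : Submodule UAInf (Verma Λ) | N ≠ ⊤} = LinearMap.ker (hv.vermaLift hι) := by
  have hcoatom := LinearMap.isCoatom_ker_of_surjective (hv.vermaLift_surjective hι)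
  have h0 : vermaVec Λ ≠ 0 := fun h => hv.ne_zero <| by
    rw [← hv.vermaLift_vermaVec hι, h, map_zero]
  exact (hcoatom.le_iff.mp (le_sSup hcoatom.1)).resolve_left (sSup_ne_top_ne_top_verma Λ h0)

end

theorem nonempty_equiv_irr [LieModule ℂ AInf M] [LieModule.IsIrreducible ℂ AInf M]
    {Λ : Module.Dual ℂ cartan} {v : M} (hv : IsHighestWeightVector Λ v) :
    Nonempty (M ≃ₗ⁅ℂ, AInf⁆ Irr Λ) := by
  let _ : Module UAInf M := envelopingModule ℂ AInf M
  have : IsScalarTower ℂ UAInf M := envelopingModule_isScalarTower ℂ AInf M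
  have hι (x : AInf) (w : M) : ι ℂ x • w = ⁅x, w⁆ := envelopingModule_ι_smul x w
  have : IsSimpleModule UAInf M := isSimpleModule_of_isIrreducible hι
  let e : Irr Λ ≃ₗ[UAInf] M :=
    (Submodule.quotEquivOfEq _ _ (hv.sSup_ne_top_eq_ker_vermaLift hι)).trans
      ((hv.vermaLift hι).quotKerEquivOfSurjective (hv.vermaLift_surjective hι))
  exact ⟨lieModuleEquivOfLinearEquiv hι (fun _ _ => rfl) e.symm⟩

end IsHighestWeightVector

end HighestWeightVector

/-! ### Occupation of levels -/

namespace FermionPair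

variable {F : Type} [AddCommGroup F] [Module ℂ F] (m : FermionPair F)

theorem a_b_apply (i j : ℤ) (v : F) :
    m.a i (m.b j v) = (if i = j then v else 0) - m.b j (m.a i v) := by
  rw [eq_sub_iff_add_eq]
  refine (LinearMap.congr_fun (m.ab i j) v).trans ?_
  split_ifs <;> rfl

theorem b_a_apply (i j : ℤ) (v : F) :
    m.b j (m.a i v) = (if i = j then v else 0) - m.a i (m.b j v) := by
  rw [a_b_apply, sub_sub_cancel]

theorem a_a_apply (i j : ℤ) (v : F) : m.a i (m.a j v) = -m.a j (m.a i v) :=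
  LinearMap.congr_fun (m.a_comm i j) v

theorem b_b_apply (i j : ℤ) (v : F) : m.b i (m.b j v) = -m.b j (m.b i v) :=
  LinearMap.congr_fun (m.b_comm i j) v

theorem a_sq_apply (i : ℤ) (v : F) : m.a i (m.a i v) = 0 :=
  have := IsAddTorsionFree.of_isTorsionFree ℂ F
  self_eq_neg.mp (m.a_a_apply i i v)

theorem b_sq_apply (i : ℤ) (v : F) : m.b i (m.b i v) = 0 :=
  have := IsAddTorsionFree.of_isTorsionFree ℂ F
  self_eq_neg.mp (m.b_b_apply i i v)

theorem nop_apply (i j : ℤ) (v : F) :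
    m.nop i j v = m.a i (m.b j v) - (if i = j then ind i else 0) • v := by
  rw [nop_eq]
  rfl

theorem nop_apply_of_ne {i j : ℤ} (h : i ≠ j) (v : F) : m.nop i j v = m.a i (m.b j v) := by
  rw [nop_apply, if_neg h, zero_smul, sub_zero]

/-- The space of vectors in which exactly the levels in `S` are occupied. -/
def states (S : Set ℤ) : Submodule ℂ F :=
  (⨅ i ∈ S, LinearMap.ker (m.a i)) ⊓ ⨅ i ∈ Sᶜ, LinearMap.ker (m.b i)

variable {m} {S : Set ℤ} {v : F}

theorem mem_states : v ∈ m.states S ↔ (∀ i ∈ S, m.a i v = 0) ∧ ∀ i, i ∉ S → m.b i v = 0 := by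
  simp only [states, Submodule.mem_inf, Submodule.mem_iInf, LinearMap.mem_ker, Set.mem_compl_iff]

theorem a_mem_states (hv : v ∈ m.states S) (i : ℤ) : m.a i v ∈ m.states (insert i S) := by
  rw [mem_states] at hv ⊢
  refine ⟨fun k hk => ?_, fun k hk => ?_⟩
  · obtain rfl | hk := Set.mem_insert_iff.mp hk
    · exact m.a_sq_apply _ _
    · rw [a_a_apply, hv.1 k hk, map_zero, neg_zero]
  · rw [Set.mem_insert_iff, not_or] at hk
    rw [b_a_apply, if_neg (Ne.symm hk.1), hv.2 k hk.2, map_zero, sub_zero]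

theorem b_mem_states (hv : v ∈ m.states S) (j : ℤ) : m.b j v ∈ m.states (S \ {j}) := by
  rw [mem_states] at hv ⊢
  refine ⟨fun k hk => ?_, fun k hk => ?_⟩
  · rw [a_b_apply, if_neg (show k ≠ j from hk.2), hv.1 k hk.1, map_zero, sub_zero]
  · obtain rfl | hkj := eq_or_ne k j
    · exact m.b_sq_apply _ _
    · rw [b_b_apply, hv.2 k fun h => hk ⟨h, hkj⟩, map_zero, neg_zero]

theorem a_b_of_mem_states (hv : v ∈ m.states S) {j : ℤ} (hj : j ∈ S) : m.a j (m.b j v) = v := by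
  rw [a_b_apply, (mem_states.mp hv).1 j hj, if_pos rfl, map_zero, sub_zero]

theorem b_a_of_mem_states (hv : v ∈ m.states S) {j : ℤ} (hj : j ∉ S) : m.b j (m.a j v) = v := by
  rw [b_a_apply, (mem_states.mp hv).2 j hj, if_pos rfl, map_zero, sub_zero]

variable (m) in
/-- Occupying the level `j`, as an equivalence whose inverse vacates it. -/
def statesInsertEquiv {j : ℤ} (hj : j ∉ S) : m.states S ≃ₗ[ℂ] m.states (insert j S) :=
  .ofLinearMap ((m.a j).restrict fun _ hv => a_mem_states hv j)
    ((m.b j).restrict fun _ hv => by simpa [Set.insert_sdiff_of_mem, hj] using b_mem_states hv j)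
    (LinearMap.ext fun w => Subtype.ext (a_b_of_mem_states w.2 (Set.mem_insert j S)))
    (LinearMap.ext fun w => Subtype.ext (b_a_of_mem_states w.2 hj))

theorem finrank_states_Iic (n : ℤ) :
    Module.finrank ℂ (m.states (Set.Iic n)) = Module.finrank ℂ (m.states (Set.Iic 0)) := by
  have hsucc (k : ℤ) : Module.finrank ℂ (m.states (Set.Iic k))
      = Module.finrank ℂ (m.states (Set.Iic (k + 1))) := by
    rw [← Order.succ_eq_add_one, Order.Iic_succ]
    exact (m.statesInsertEquiv (by simp)).finrank_eq
  induction n using Int.induction_on with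
  | zero => rfl
  | succ n ih => rw [← hsucc, ih]
  | pred n ih => rw [hsucc, sub_add_cancel, ih]

/-! ### Subspaces stable under normally ordered products -/

variable (m) in
/-- The subspace `N` is stable under all `:a_i b_j:`. -/
def Stable (N : Submodule ℂ F) : Prop := ∀ i j : ℤ, ∀ v ∈ N, m.nop i j v ∈ N

theorem Stable.a_b_mem {N : Submodule ℂ F} (hN : m.Stable N) (i j : ℤ) (hv : v ∈ N) :
    m.a i (m.b j v) ∈ N := by
  have h := N.add_mem (hN i j v hv) (N.smul_mem (if i = j then ind i else 0) hv)
  rwa [nop_apply, sub_add_cancel] at h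

theorem Stable.b_a_mem {N : Submodule ℂ F} (hN : m.Stable N) (i : ℤ) (hv : v ∈ N) :
    m.b i (m.a i v) ∈ N := by
  rw [b_a_apply, if_pos rfl]
  exact N.sub_mem hv (hN.a_b_mem i i hv)

variable (m) in
/-- A vector on which one of `a_i` and `b_i` vanishes: the level `i` is occupied or vacant. -/
def IsPureAt (i : ℤ) (v : F) : Prop := m.a i v = 0 ∨ m.b i v = 0

theorem IsPureAt.a_b {j : ℤ} (h : m.IsPureAt j v) (i : ℤ) : m.IsPureAt j (m.a i (m.b i v)) := by
  obtain rfl | hij := eq_or_ne j i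
  · exact .inl (m.a_sq_apply _ _)
  · refine h.imp (fun h => ?_) fun h => ?_
    · rw [a_a_apply, a_b_apply, h, if_neg hij, map_zero, sub_zero, map_zero, neg_zero]
    · rw [b_a_apply, if_neg hij.symm, b_b_apply, h, map_zero, neg_zero, map_zero, sub_zero]

theorem IsPureAt.b_a {j : ℤ} (h : m.IsPureAt j v) (i : ℤ) : m.IsPureAt j (m.b i (m.a i v)) := by
  obtain rfl | hij := eq_or_ne j i
  · exact .inr (m.b_sq_apply _ _)
  · refine h.imp (fun h => ?_) fun h => ?_
    · rw [a_b_apply, if_neg hij, a_a_apply, h, map_zero, neg_zero, map_zero, sub_zero]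
    · rw [b_b_apply, b_a_apply, h, if_neg hij.symm, map_zero, sub_zero, map_zero, neg_zero]

theorem Stable.mem_span_isPureAt {N : Submodule ℂ F} (hN : m.Stable N) (hv : v ∈ N) :
    v ∈ Submodule.span ℂ {y | y ∈ N ∧ ∀ i, m.IsPureAt i y} := by
  have key (s : Finset ℤ) : ∀ v ∈ N, (∀ i ∉ s, m.IsPureAt i v) →
      v ∈ Submodule.span ℂ {y | y ∈ N ∧ ∀ i, m.IsPureAt i y} := by
    induction s using Finset.induction_on with
    | empty => exact fun v hv h => Submodule.subset_span ⟨hv, fun i => h i (Finset.notMem_empty i)⟩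
    | insert i s _ ih =>
      intro v hv h
      have hsplit : m.a i (m.b i v) + m.b i (m.a i v) = v := by
        rw [a_b_apply, if_pos rfl, sub_add_cancel]
      rw [← hsplit]
      refine Submodule.add_mem _ (ih _ (hN.a_b_mem i i hv) fun j hj => ?_)
        (ih _ (hN.b_a_mem i hv) fun j hj => ?_)
      · obtain rfl | hji := eq_or_ne j i
        · exact .inl (m.a_sq_apply _ _)
        · exact (h j (by simp [hji, hj])).a_b i
      · obtain rfl | hji := eq_or_ne j i
        · exact .inr (m.b_sq_apply _ _)
        · exact (h j (by simp [hji, hj])).b_a i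
  obtain ⟨M, hb, ha⟩ := m.fin v
  exact key (box M) v hv fun i hi => (not_mem_box hi).imp (ha i) (hb i)

variable (m) in
/-- The vectors `y` and `z` generate the same subspace stable under all `:a_i b_j:`. -/
def Linked (y z : F) : Prop := ∀ N : Submodule ℂ F, m.Stable N → (y ∈ N ↔ z ∈ N)

theorem exists_linked_move (hv : v ∈ m.states S) (hv0 : v ≠ 0) {i j : ℤ} (hi : i ∉ S)
    (hj : j ∈ S) : ∃ z ∈ m.states (insert i (S \ {j})), z ≠ 0 ∧ m.Linked v z := by
  have hback : m.a j (m.b i (m.a i (m.b j v))) = v := by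
    rw [b_a_of_mem_states (b_mem_states hv j) fun h => hi h.1, a_b_of_mem_states hv hj]
  refine ⟨m.a i (m.b j v), a_mem_states (b_mem_states hv j) i, fun h => hv0 ?_, fun N hN =>
    ⟨hN.a_b_mem i j, fun h => hback ▸ hN.a_b_mem j i h⟩⟩
  rw [← hback, h, map_zero, map_zero]

theorem exists_linked_of_encard_sdiff {C : Set ℤ} {k : ℕ} (hSC : (S \ C).encard = k)
    (hCS : (C \ S).encard = k) (hv : v ∈ m.states S) (hv0 : v ≠ 0) :
    ∃ z ∈ m.states C, z ≠ 0 ∧ m.Linked v z := by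
  induction k generalizing S v with
  | zero =>
    rw [Nat.cast_zero, Set.encard_eq_zero, Set.sdiff_eq_empty] at hSC hCS
    exact ⟨v, hSC.antisymm hCS ▸ hv, hv0, fun _ _ => Iff.rfl⟩
  | succ k ih =>
    obtain ⟨j, hj⟩ : (S \ C).Nonempty := Set.encard_ne_zero.mp (by rw [hSC]; simp)
    obtain ⟨i, hi⟩ : (C \ S).Nonempty := Set.encard_ne_zero.mp (by rw [hCS]; simp)
    obtain ⟨y, hy, hy0, hvy⟩ := exists_linked_move hv hv0 hi.2 hj.1
    have hSC' : insert i (S \ {j}) \ C = (S \ C) \ {j} := by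
      rw [Set.insert_sdiff_of_mem _ hi.1, sdiff_right_comm]
    have hCS' : C \ insert i (S \ {j}) = (C \ S) \ {i} := by
      ext k
      have : k = j → k ∉ C := fun h => h ▸ hj.2
      simp only [Set.mem_sdiff, Set.mem_insert_iff, Set.mem_singleton_iff]
      tauto
    obtain ⟨z, hz, hz0, hyz⟩ := ih
      (by rw [hSC', Set.encard_sdiff_singleton_of_mem hj, hSC]; rfl)
      (by rw [hCS', Set.encard_sdiff_singleton_of_mem hi, hCS]; rfl) hy hy0
    exact ⟨z, hz, hz0, fun N hN => (hvy N hN).trans (hyz N hN)⟩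

theorem exists_linked_Iic (hv : ∀ i, m.IsPureAt i v) (hv0 : v ≠ 0) :
    ∃ n : ℤ, ∃ z ∈ m.states (Set.Iic n), z ≠ 0 ∧ m.Linked v z := by
  classical
  obtain ⟨M, hb, ha⟩ := m.fin v
  set S : Set ℤ := {i | m.b i v ≠ 0}
  have hvS : v ∈ m.states S := mem_states.mpr ⟨fun i => (hv i).resolve_right, fun i => not_not.mp⟩
  have hle (i : ℤ) (hi : i ∈ S) : i ≤ M := not_lt.mp fun h => hi (hb i h)
  have hmem (i : ℤ) (hi : i < -M) : i ∈ S := fun hbi => hv0 <| by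
    have h := m.a_b_apply i i v
    rwa [ha i hi, hbi, map_zero, map_zero, if_pos rfl, sub_zero, eq_comm] at h
  set T := (box M).filter (· ∈ S)
  set n : ℤ := T.card - M - 1
  have hcard : T.card = (Finset.Icc (-M : ℤ) n).card := by
    rw [Int.card_Icc]
    omega
  have hT (i : ℤ) : i ∈ T ↔ (-M ≤ i ∧ i ≤ M) ∧ i ∈ S := by
    rw [Finset.mem_filter, box, Finset.mem_Icc]
  have hSn : S \ Set.Iic n = ↑(T \ Finset.Icc (-M : ℤ) n) := by
    ext i
    have := hle i
    simp only [Set.mem_sdiff, Set.mem_Iic, Finset.coe_sdiff, Finset.mem_coe, hT, Finset.mem_Icc]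
    grind
  have hnS : Set.Iic n \ S = ↑(Finset.Icc (-M : ℤ) n \ T) := by
    ext i
    have := hle i
    have := hmem i
    simp only [Set.mem_sdiff, Set.mem_Iic, Finset.coe_sdiff, Finset.mem_coe, hT, Finset.mem_Icc]
    grind
  refine ⟨n, exists_linked_of_encard_sdiff (k := (T \ Finset.Icc (-M : ℤ) n).card) ?_ ?_ hvS hv0⟩
  · rw [hSn, Set.encard_coe_eq_coe_finsetCard]
  · rw [hnS, Set.encard_coe_eq_coe_finsetCard, Finset.card_sdiff_comm hcard]

/-! ### The action on states -/

theorem act_eq_zero_of_mem_states_Iic {n : ℤ} (hv : v ∈ m.states (Set.Iic n)) {A : Band}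
    (hA : ∀ i j, j ≤ i → A.1 i j = 0) : m.act A v = 0 := by
  obtain ⟨M, hM⟩ := (m.act_eventually A v).exists
  rw [hM]
  refine Finset.sum_eq_zero fun i _ => Finset.sum_eq_zero fun j _ => ?_
  obtain hij | hij := le_or_gt j i
  · rw [hA i j hij, zero_smul]
  · rw [nop_apply_of_ne m hij.ne]
    obtain hj | hj := le_or_gt j n
    · rw [a_b_apply, if_neg hij.ne, (mem_states.mp hv).1 i (hij.le.trans hj), map_zero, sub_zero,
        smul_zero]
    · rw [(mem_states.mp hv).2 j (Set.notMem_Iic.mpr hj), map_zero, smul_zero]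

variable (m) in
theorem act_zero (v : F) : m.act 0 v = 0 := by
  rw [← zero_smul ℂ (0 : Band), act_smul_left, zero_smul]

variable (m) in
/-- The action of a band matrix as a linear map. -/
def actHom (A : Band) : Module.End ℂ F where
  toFun := m.act A
  map_add' := m.act_add_right A
  map_smul' t v := m.act_smul_right t A v

theorem nop_self_apply_of_mem_states_Iic {n : ℤ} (hv : v ∈ m.states (Set.Iic n)) (i : ℤ) :
    m.nop i i v = (((if i ∈ Finset.Ioc 0 n then 1 else 0) -
      if i ∈ Finset.Ioc n 0 then 1 else 0 : ℂ)) • v := by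
  rw [nop_apply, if_pos rfl, ind]
  simp only [Finset.mem_Ioc]
  obtain hi | hi := le_or_gt i n
  · rw [a_b_of_mem_states hv (Set.mem_Iic.mpr hi)]
    obtain h0 | h0 := le_or_gt i 0
    · simp [h0, not_lt.mpr h0, not_lt.mpr hi]
    · simp [h0, hi, not_le.mpr h0]
  · rw [(mem_states.mp hv).2 i (Set.notMem_Iic.mpr hi), map_zero]
    obtain h0 | h0 := le_or_gt i 0
    · simp [h0, hi, not_lt.mpr h0]
    · simp [h0, not_le.mpr hi, not_le.mpr h0]

section Diagonal

variable {A : Band}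

theorem act_diag_eventually (hA : ∀ i j, i ≠ j → A.1 i j = 0) (v : F) :
    ∀ᶠ M in atTop, m.act A v = ∑ i ∈ box M, A.1 i i • m.nop i i v := by
  filter_upwards [m.act_eventually A v] with M hM
  rw [hM]
  refine Finset.sum_congr rfl fun i hi => Finset.sum_eq_single_of_mem i hi fun j _ hj => ?_
  rw [hA i j hj.symm, zero_smul]

theorem act_diag_a (hA : ∀ i j, i ≠ j → A.1 i j = 0) (i : ℤ) (v : F) :
    m.act A (m.a i v) = m.a i (m.act A v) + A.1 i i • m.a i v := by
  obtain ⟨M, h1, h2, hM⟩ := ((act_diag_eventually hA v).and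
    ((act_diag_eventually hA (m.a i v)).and (eventually_ge_atTop i.natAbs))).exists
  have hi : i ∈ box M := Finset.mem_Icc.mpr (by omega)
  have hnop (k : ℤ) :
      m.nop k k (m.a i v) = m.a i (m.nop k k v) + if k = i then m.a i v else 0 := by
    rw [nop_apply, nop_apply, b_a_apply, map_sub, map_sub, map_smul, m.a_a_apply k i]
    obtain rfl | hk := eq_or_ne k i
    · rw [if_pos rfl, if_pos rfl, if_pos rfl]
      abel
    · rw [if_neg hk.symm, if_neg hk, map_zero]
      abel
  rw [h1, h2]
  simp only [hnop, smul_add, Finset.sum_add_distrib, map_sum, map_smul, smul_ite, smul_zero,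
    Finset.sum_ite_eq', if_pos hi]

theorem act_diag_b (hA : ∀ i j, i ≠ j → A.1 i j = 0) (i : ℤ) (v : F) :
    m.act A (m.b i v) = m.b i (m.act A v) - A.1 i i • m.b i v := by
  obtain ⟨M, h1, h2, hM⟩ := ((act_diag_eventually hA v).and
    ((act_diag_eventually hA (m.b i v)).and (eventually_ge_atTop i.natAbs))).exists
  have hi : i ∈ box M := Finset.mem_Icc.mpr (by omega)
  have hnop (k : ℤ) :
      m.nop k k (m.b i v) = m.b i (m.nop k k v) - if k = i then m.b i v else 0 := by
    rw [nop_apply, nop_apply, map_sub, map_smul, b_a_apply, m.b_b_apply k i, map_neg]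
    obtain rfl | hk := eq_or_ne k i
    · rw [if_pos rfl, if_pos rfl]
      abel
    · rw [if_neg hk, if_neg hk]
      abel
  rw [h1, h2]
  simp only [hnop, smul_sub, Finset.sum_sub_distrib, map_sum, map_smul, smul_ite, smul_zero,
    Finset.sum_ite_eq', if_pos hi]

theorem act_diag_of_mem_states_Iic (hA : ∀ i j, i ≠ j → A.1 i j = 0) {n : ℤ}
    (hv : v ∈ m.states (Set.Iic n)) :
    m.act A v = (∑ i ∈ Finset.Ioc 0 n, A.1 i i - ∑ i ∈ Finset.Ioc n 0, A.1 i i) • v := by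
  obtain ⟨M, h1, hM⟩ := ((act_diag_eventually hA v).and (eventually_ge_atTop n.natAbs)).exists
  rw [h1]
  simp only [nop_self_apply_of_mem_states_Iic hv, smul_smul, ← Finset.sum_smul, mul_sub,
    Finset.sum_sub_distrib, mul_ite, mul_one, mul_zero, Finset.sum_ite_mem]
  congr 3
  all_goals
    refine Finset.inter_eq_right.mpr fun i hi => ?_
    rw [Finset.mem_Ioc] at hi
    exact Finset.mem_Icc.mpr (by omega)

end Diagonal

/-! ### Charge -/

variable (m) in
/-- The space of vectors of charge `n`, on which the identity matrix acts by `n`. -/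
def charge (n : ℤ) : Submodule ℂ F := (m.actHom (diagBand fun _ => 1)).eigenspace (n : ℂ)

theorem mem_charge {n : ℤ} : v ∈ m.charge n ↔ m.act (diagBand fun _ => 1) v = (n : ℂ) • v :=
  Module.End.mem_eigenspace_iff

variable (m) in
theorem iSupIndep_charge : iSupIndep m.charge :=
  (Module.End.eigenspaces_iSupIndep _).comp Int.cast_injective

theorem states_Iic_le_charge (n : ℤ) : m.states (Set.Iic n) ≤ m.charge n := by
  intro v hv
  rw [mem_charge, act_diag_of_mem_states_Iic (fun _ _ => diagBand_apply_ne _) hv]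
  simp only [diagBand_apply_self, Finset.sum_const, Int.card_Ioc, nsmul_eq_mul, mul_one]
  congr 1
  have h : (((n - 0).toNat : ℤ) - (0 - n).toNat : ℤ) = n := by omega
  exact_mod_cast h

theorem stable_charge (n : ℤ) : m.Stable (m.charge n) := by
  have hd : ∀ i j, i ≠ j → (diagBand fun _ => 1).1 i j = 0 := fun _ _ => diagBand_apply_ne _
  intro i j v hv
  rw [nop_apply]
  refine Submodule.sub_mem _ (mem_charge.mpr ?_) (Submodule.smul_mem _ _ hv)
  rw [act_diag_a hd, act_diag_b hd, mem_charge.mp hv, diagBand_apply_self, diagBand_apply_self,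
    map_sub, map_smul, map_smul, one_smul, one_smul, sub_add_cancel]

theorem mem_iff_states_Iic_le (hm : Module.finrank ℂ (m.states (Set.Iic 0)) = 1) {n : ℤ}
    (hv : ∀ i, m.IsPureAt i v) (hv0 : v ≠ 0) (hvn : v ∈ m.charge n) {N : Submodule ℂ F}
    (hN : m.Stable N) : v ∈ N ↔ m.states (Set.Iic n) ≤ N := by
  obtain ⟨k, z, hz, hz0, hlink⟩ := exists_linked_Iic hv hv0
  have hzn : z ∈ m.charge n := (hlink _ (stable_charge n)).mp hvn
  obtain rfl : k = n := by
    by_contra hkn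
    exact hz0 (Submodule.disjoint_def.mp (m.iSupIndep_charge.pairwiseDisjoint hkn) z
      (states_Iic_le_charge k hz) hzn)
  rw [hlink N hN]
  refine ⟨fun h w hw => ?_, fun h => h hz⟩
  obtain ⟨t, ht⟩ := (finrank_eq_one_iff_of_nonzero' (⟨z, hz⟩ : m.states (Set.Iic k))
    fun h => hz0 (congrArg Subtype.val h)).mp ((finrank_states_Iic k).trans hm) ⟨w, hw⟩
  rw [← show t • z = w from congrArg Subtype.val ht]
  exact N.smul_mem t h

theorem charge_le_of_stable (hm : Module.finrank ℂ (m.states (Set.Iic 0)) = 1) {n : ℤ}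
    {N : Submodule ℂ F} (hN : m.Stable N) (hvN : v ∈ N) (hvn : v ∈ m.charge n) (hv0 : v ≠ 0) :
    m.charge n ≤ N := by
  have hinf : m.Stable (N ⊓ m.charge n) :=
    fun i j w hw => ⟨hN i j w hw.1, stable_charge n i j w hw.2⟩
  have hle : m.states (Set.Iic n) ≤ N := by
    by_contra hle
    refine hv0 ((Submodule.span_le (p := ⊥)).mpr ?_ (hinf.mem_span_isPureAt ⟨hvN, hvn⟩))
    rintro y ⟨⟨hyN, hyn⟩, hy⟩
    by_contra hy0
    exact hle ((mem_iff_states_Iic_le hm hy hy0 hyn hN).mp hyN)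
  intro w hw
  refine Submodule.span_le.mpr ?_ ((stable_charge n).mem_span_isPureAt hw)
  rintro y ⟨hyn, hy⟩
  obtain rfl | hy0 := eq_or_ne y 0
  · exact N.zero_mem
  · exact (mem_iff_states_Iic_le hm hy hy0 hyn hN).mpr hle

end FermionPair

/-! ### The universal property of Fock spaces -/

section FockMap

variable {X : Type} {F : Type*} {β : X → X → ℂ} {P : Set X} [AddCommGroup F] [Module ℂ F]

/-- The representation of the Clifford algebra in which the generators act by a given family of
operators satisfying the Clifford relations. -/
def cliffRep (T : X → Module.End ℂ F) (hT : ∀ x y, T x * T y + T y * T x = β x y • 1) :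
    Cliff β →ₐ[ℂ] Module.End ℂ F :=
  CliffordAlgebra.lift (cliffForm β) ⟨Finsupp.linearCombination ℂ T, fun f => by
    set L := Finsupp.linearCombination ℂ T
    have hpolar : (LinearMap.mul ℂ (Module.End ℂ F)).compl₁₂ L L
        + ((LinearMap.mul ℂ (Module.End ℂ F)).compl₁₂ L L).flip
        = (Finsupp.linearCombination ℂ fun x => Finsupp.linearCombination ℂ (β x)).compr₂
          ((LinearMap.id : ℂ →ₗ[ℂ] ℂ).smulRight (1 : Module.End ℂ F)) := by
      ext x y : 4
      simpa [L] using hT x y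
    have h := LinearMap.congr_fun₂ hpolar f f
    simp only [LinearMap.add_apply, LinearMap.compl₁₂_apply, LinearMap.mul_apply',
      LinearMap.flip_apply, LinearMap.compr₂_apply, LinearMap.smulRight_apply,
      LinearMap.id_apply] at h
    rw [Algebra.algebraMap_eq_smul_one, cliffForm, FunLike.coe_smul, Pi.smul_apply,
      LinearMap.BilinMap.toQuadraticMap_apply, smul_assoc, ← h, ← two_smul ℂ, smul_smul,
      one_div_mul_cancel two_ne_zero, one_smul]⟩

theorem cliffRep_gen (T : X → Module.End ℂ F) (hT : ∀ x y, T x * T y + T y * T x = β x y • 1)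
    (x : X) : cliffRep T hT (gen β x) = T x := by
  rw [cliffRep, gen, CliffordAlgebra.lift_ι_apply, Finsupp.linearCombination_single, one_smul]

/-- The linear map from a Fock space determined by the image of the vacuum. -/
def fockMap (T : X → Module.End ℂ F) (hT : ∀ x y, T x * T y + T y * T x = β x y • 1)
    (v : F) (hv : ∀ x ∈ P, T x v = 0) : Fock β P →ₗ[ℂ] F :=
  ((vacIdeal β P).restrictScalars ℂ).liftQ
    ((LinearMap.applyₗ v).comp (cliffRep T hT).toLinearMap) (fun u hu => by
      change cliffRep T hT u v = 0
      replace hu : u ∈ vacIdeal β P := hu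
      induction hu using Submodule.span_induction with
      | mem u hu =>
        obtain ⟨x, hx, rfl⟩ := hu
        rw [cliffRep_gen, hv x hx]
      | zero => rw [map_zero, LinearMap.zero_apply]
      | add u w _ _ hu hw => rw [map_add, LinearMap.add_apply, hu, hw, add_zero]
      | smul a u _ hu =>
        rw [smul_eq_mul, map_mul, Module.End.mul_apply, hu, map_zero]) ∘ₗ
    (Submodule.Quotient.restrictScalarsEquiv ℂ (vacIdeal β P)).symm.toLinearMap

section

variable (T : X → Module.End ℂ F) (hT : ∀ x y, T x * T y + T y * T x = β x y • 1)
  (v : F) (hv : ∀ x ∈ P, T x v = 0)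

theorem fockMap_mk (u : Cliff β) :
    fockMap T hT v hv (Submodule.Quotient.mk (p := vacIdeal β P) u) = cliffRep T hT u v := rfl

theorem fockMap_vac : fockMap T hT v hv (vac β P) = v := by
  rw [vac, fockMap_mk, map_one, Module.End.one_apply]

theorem fockMap_op (x : X) (w : Fock β P) :
    fockMap T hT v hv (op β P x w) = T x (fockMap T hT v hv w) := by
  obtain ⟨u, rfl⟩ := Submodule.Quotient.mk_surjective (vacIdeal β P) w
  change fockMap T hT v hv (Submodule.Quotient.mk (p := vacIdeal β P) (gen β x * u)) = _
  rw [fockMap_mk, fockMap_mk, map_mul, cliffRep_gen, Module.End.mul_apply]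

end

theorem fock_hom_ext {f g : Fock β P →ₗ[ℂ] F} {T : X → Module.End ℂ F}
    (hf : ∀ x w, f (op β P x w) = T x (f w)) (hg : ∀ x w, g (op β P x w) = T x (g w))
    (h : f (vac β P) = g (vac β P)) : f = g := by
  refine LinearMap.ext fun w => ?_
  induction w using fock_induction with
  | h0 => rw [map_zero, map_zero]
  | hv => exact h
  | ha v w hv hw => rw [map_add, map_add, hv, hw]
  | hs t v hv => rw [map_smul, map_smul, hv]
  | ho x v hv => rw [hf, hg, hv]

section Functoriality

variable {Y : Type} {β' : Y → Y → ℂ} {P' : Set Y} (hβ' : ∀ x y, β' x y = β' y x)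

/-- The functoriality of Fock spaces in the set of generators. -/
def fockHom (e : X → Y) (he : ∀ x y, β' (e x) (e y) = β x y) (hP : ∀ x ∈ P, e x ∈ P') :
    Fock β P →ₗ[ℂ] Fock β' P' :=
  fockMap (fun x => op β' P' (e x)) (fun x y => by rw [op_anticomm β' P' hβ', he]) (vac β' P')
    fun x hx => op_vac β' P' (hP x hx)

section

variable (e : X → Y) (he : ∀ x y, β' (e x) (e y) = β x y) (hP : ∀ x ∈ P, e x ∈ P')

theorem fockHom_vac : fockHom hβ' e he hP (vac β P) = vac β' P' := fockMap_vac _ _ _ _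

theorem fockHom_op (x : X) (w : Fock β P) :
    fockHom hβ' e he hP (op β P x w) = op β' P' (e x) (fockHom hβ' e he hP w) :=
  fockMap_op _ _ _ _ x w

end

/-- The isomorphism of Fock spaces induced by a relabelling of the generators. -/
def fockEquiv (e : X ≃ Y) (he : ∀ x y, β' (e x) (e y) = β x y) (hP : ∀ x, e x ∈ P' ↔ x ∈ P) :
    Fock β P ≃ₗ[ℂ] Fock β' P' :=
  LinearEquiv.ofLinearMap (fockHom hβ' e he fun x => (hP x).mpr)
    (fockHom (fun x y => by rw [← he, ← he, hβ']) e.symm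
      (fun x y => by rw [← he, e.apply_symm_apply, e.apply_symm_apply])
      fun y hy => (hP _).mp (by rwa [e.apply_symm_apply]))
    (fock_hom_ext (T := op β' P')
      (fun y w => by simp only [LinearMap.comp_apply, fockHom_op, e.apply_symm_apply])
      (fun _ _ => rfl) (by simp only [LinearMap.comp_apply, fockHom_vac, LinearMap.id_apply]))
    (fock_hom_ext (T := op β P)
      (fun x w => by simp only [LinearMap.comp_apply, fockHom_op, e.symm_apply_apply])
      (fun _ _ => rfl) (by simp only [LinearMap.comp_apply, fockHom_vac, LinearMap.id_apply]))

theorem fockEquiv_op (e : X ≃ Y) (he : ∀ x y, β' (e x) (e y) = β x y)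
    (hP : ∀ x, e x ∈ P' ↔ x ∈ P) (x : X) (w : Fock β P) :
    fockEquiv hβ' e he hP (op β P x w) = op β' P' (e x) (fockEquiv hβ' e he hP w) :=
  fockHom_op hβ' e he (fun x => (hP x).mpr) x w

end Functoriality

/-! ### The vacuum is nonzero -/

section Exterior

variable (β P)

open Classical in
/-- The model of the Clifford relations on the exterior algebra: generators in `P` act by
contraction, the others by multiplication. -/
def exteriorOp (x : X) : Module.End ℂ (ExteriorAlgebra ℂ (X →₀ ℂ)) :=
  if x ∈ P then CliffordAlgebra.contractLeft (Finsupp.linearCombination ℂ (β x))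
  else LinearMap.mulLeft ℂ (ExteriorAlgebra.ι ℂ (Finsupp.single x 1))

variable {β P}

theorem exteriorOp_of_mem {x : X} (hx : x ∈ P) :
    exteriorOp β P x = CliffordAlgebra.contractLeft (Finsupp.linearCombination ℂ (β x)) :=
  if_pos hx

theorem exteriorOp_of_notMem {x : X} (hx : x ∉ P) :
    exteriorOp β P x = LinearMap.mulLeft ℂ (ExteriorAlgebra.ι ℂ (Finsupp.single x 1)) :=
  if_neg hx

theorem exteriorOp_anticomm_mixed {x y : X} (hx : x ∈ P) (hy : y ∉ P) :
    exteriorOp β P x * exteriorOp β P y + exteriorOp β P y * exteriorOp β P x = β x y • 1 := by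
  refine LinearMap.ext fun u => ?_
  rw [exteriorOp_of_mem hx, exteriorOp_of_notMem hy, LinearMap.add_apply, Module.End.mul_apply,
    Module.End.mul_apply, LinearMap.mulLeft_apply, LinearMap.mulLeft_apply,
    ExteriorAlgebra.ι, CliffordAlgebra.contractLeft_ι_mul, sub_add_cancel,
    Finsupp.linearCombination_single, one_smul, LinearMap.smul_apply, Module.End.one_apply]

theorem exteriorOp_anticomm (hβ : ∀ x y, β x y = β y x) (hP : ∀ x ∈ P, ∀ y ∈ P, β x y = 0)
    (hP' : ∀ x ∉ P, ∀ y ∉ P, β x y = 0) (x y : X) :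
    exteriorOp β P x * exteriorOp β P y + exteriorOp β P y * exteriorOp β P x = β x y • 1 := by
  by_cases hx : x ∈ P <;> by_cases hy : y ∈ P
  · rw [hP x hx y hy, zero_smul, exteriorOp_of_mem hx, exteriorOp_of_mem hy]
    refine LinearMap.ext fun u => ?_
    rw [LinearMap.add_apply, Module.End.mul_apply, Module.End.mul_apply,
      CliffordAlgebra.contractLeft_comm, neg_add_cancel, LinearMap.zero_apply]
  · exact exteriorOp_anticomm_mixed hx hy
  · rw [add_comm, hβ]
    exact exteriorOp_anticomm_mixed hy hx
  · rw [hP' x hx y hy, zero_smul, exteriorOp_of_notMem hx, exteriorOp_of_notMem hy]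
    refine LinearMap.ext fun u => ?_
    rw [LinearMap.add_apply, Module.End.mul_apply, Module.End.mul_apply, LinearMap.mulLeft_apply,
      LinearMap.mulLeft_apply, LinearMap.mulLeft_apply, LinearMap.mulLeft_apply, ← mul_assoc,
      ← mul_assoc, ← add_mul, ExteriorAlgebra.ι_add_mul_swap, zero_mul, LinearMap.zero_apply]

theorem vac_ne_zero (hβ : ∀ x y, β x y = β y x) (hP : ∀ x ∈ P, ∀ y ∈ P, β x y = 0)
    (hP' : ∀ x ∉ P, ∀ y ∉ P, β x y = 0) : vac β P ≠ 0 := by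
  intro h0
  have h := fockMap_vac (P := P) (exteriorOp β P) (exteriorOp_anticomm hβ hP hP') 1
    fun x hx => by rw [exteriorOp_of_mem hx, CliffordAlgebra.contractLeft_one]
  rw [h0, map_zero] at h
  exact zero_ne_one h

end Exterior

end FockMap

/-! ### Neutral and charged fermions -/

theorem FermionPair.map_act {F F' : Type} [AddCommGroup F] [Module ℂ F] [AddCommGroup F']
    [Module ℂ F'] {m : FermionPair F} {m' : FermionPair F'} {f : F →ₗ[ℂ] F'}
    (ha : ∀ i v, f (m.a i v) = m'.a i (f v)) (hb : ∀ i v, f (m.b i v) = m'.b i (f v))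
    (A : Band) (v : F) : f (m.act A v) = m'.act A (f v) := by
  obtain ⟨M, h1, h2⟩ := ((m.act_eventually A v).and (m'.act_eventually A (f v))).exists
  rw [h1, h2]
  simp only [map_sum, map_smul, FermionPair.nop_apply, map_sub, ha, hb]

/-- The bijection between the modes `ψ^±_n` of charged fermions and the modes `φ_{k - 1/2}` of a
neutral fermion, with `k = 2 n + 1` for `ψ^+_n` and `k = 2 n + 2` for `ψ^-_n`. -/
def chargedIndex : ℤ ⊕ ℤ ≃ ℤ :=
  Equiv.ofBijective (Sum.elim (fun n => 2 * n + 1) fun n => 2 * n + 2) <| by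
    constructor
    · rintro (m | m) (n | n) h <;> simp only [Sum.elim_inl, Sum.elim_inr] at h
      · exact congrArg _ (by omega)
      · omega
      · omega
      · exact congrArg _ (by omega)
    · intro k
      obtain ⟨j, hj | hj⟩ := Int.even_or_odd' k
      · exact ⟨.inr (j - 1), by rw [Sum.elim_inr]; omega⟩
      · exact ⟨.inl j, hj.symm⟩

theorem chargedIndex_inl (n : ℤ) : chargedIndex (.inl n) = 2 * n + 1 := rfl

theorem chargedIndex_inr (n : ℤ) : chargedIndex (.inr n) = 2 * n + 2 := rfl

theorem neutralForm_comm (k l : ℤ) : neutralForm k l = neutralForm l k := by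
  rw [neutralForm, neutralForm, add_comm]

theorem neutralForm_chargedIndex (x y : ℤ ⊕ ℤ) :
    neutralForm (chargedIndex x) (chargedIndex y) = chargedForm x y := by
  rcases x with m | m <;> rcases y with n | n <;>
    simp only [chargedForm, neutralForm, chargedIndex_inl, chargedIndex_inr]
  · exact if_neg (by omega)
  · exact if_congr (by omega) rfl rfl
  · exact if_congr (by omega) rfl rfl
  · exact if_neg (by omega)

theorem one_le_chargedIndex_iff (x : ℤ ⊕ ℤ) : 1 ≤ chargedIndex x ↔ x ∈ chargedPos := by
  rcases x with m | m <;> simp only [chargedIndex_inl, chargedIndex_inr, chargedPos,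
    Set.mem_ofPred_eq, Sum.elim_inl, Sum.elim_inr, id] <;> omega

/-- The linear isomorphism `F^{⊗ 1} ≅ F^{⊗ 1/2}` given by `ψ^+_n ↦ φ_{2n + 1/2}` and
`ψ^-_n ↦ φ_{2n + 3/2}`. -/
def chargedEquivNeutral : ChargedFock ≃ₗ[ℂ] NeutralFock :=
  fockEquiv neutralForm_comm chargedIndex neutralForm_chargedIndex one_le_chargedIndex_iff

theorem chargedEquivNeutral_psiPlus (n : ℤ) (v : ChargedFock) :
    chargedEquivNeutral (ChargedFock.psiPlus n v) =
      NeutralFock.phi (2 * n + 1) (chargedEquivNeutral v) :=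
  fockEquiv_op neutralForm_comm chargedIndex neutralForm_chargedIndex one_le_chargedIndex_iff
    (.inl n) v

theorem chargedEquivNeutral_psiMinus (n : ℤ) (v : ChargedFock) :
    chargedEquivNeutral (ChargedFock.psiMinus n v) =
      NeutralFock.phi (2 * n + 2) (chargedEquivNeutral v) :=
  fockEquiv_op neutralForm_comm chargedIndex neutralForm_chargedIndex one_le_chargedIndex_iff
    (.inr n) v

theorem chargedEquivNeutral_act (A : Band) (v : ChargedFock) :
    chargedEquivNeutral (ChargedFock.pair.act A v) =
      NeutralFock.pair.act A (chargedEquivNeutral v) := by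
  refine FermionPair.map_act (f := chargedEquivNeutral.toLinearMap) (fun i v => ?_)
    (fun i v => ?_) A v
  · refine (chargedEquivNeutral_psiPlus (-i) v).trans ?_
    rw [NeutralFock.pair_a, neg_mul, mul_neg]
    rfl
  · refine (chargedEquivNeutral_psiMinus (i - 1) v).trans ?_
    rw [NeutralFock.pair_b, show 2 * (i - 1) + 2 = 2 * i by ring]
    rfl

/-- The isomorphism `F^{⊗ 1} ≅ F^{⊗ 1/2}` of `a_∞`-modules. -/
def chargedLieEquivNeutral : ChargedFock ≃ₗ⁅ℂ, AInf⁆ NeutralFock :=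
  { chargedEquivNeutral with
    map_lie' := fun {x v} => by
      change chargedEquivNeutral ⁅x, v⁆ = ⁅x, chargedEquivNeutral v⁆
      rw [ChargedFock.lie_eq, NeutralFock.lie_eq, map_add, map_smul, chargedEquivNeutral_act] }

/-! ### The Fock space of a neutral fermion -/

namespace NeutralFock

theorem phi_eq_pair_a {k : ℤ} (hk : Odd k) : phi k = pair.a ((1 - k) / 2) := by
  rw [pair_a]
  obtain ⟨j, rfl⟩ := hk
  congr 1
  omega

theorem phi_eq_pair_b {k : ℤ} (hk : ¬ Odd k) : phi k = pair.b (k / 2) := by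
  rw [pair_b, Int.mul_ediv_cancel' (Int.not_odd_iff_even.mp hk).two_dvd]

theorem vacuum_mem_states : vacuum ∈ pair.states (Set.Iic 0) := by
  refine FermionPair.mem_states.mpr ⟨fun i hi => ?_, fun i hi => ?_⟩
  all_goals
    rw [Set.mem_Iic] at hi
    refine phi_vacuum ?_
    dsimp only
    omega

theorem vacuum_ne_zero : vacuum ≠ 0 := by
  refine vac_ne_zero neutralForm_comm (fun x hx y hy => if_neg ?_) fun x hx y hy => if_neg ?_
  all_goals
    rw [Set.mem_ofPred_eq] at hx hy
    omega

/-- The eigenvalue by which bracketing with `diag(d_i)` multiplies `φ_{k - 1/2}`. -/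
def modeWeight (d : ℤ → ℂ) (k : ℤ) : ℂ := if Odd k then d ((1 - k) / 2) else -d (k / 2)

theorem word_mem_eigenspace (d : ℤ → ℂ) (l : List ℤ) :
    word l ∈ (pair.actHom (diagBand d)).eigenspace (l.map (modeWeight d)).sum := by
  have hd : ∀ i j, i ≠ j → (diagBand d).1 i j = 0 := fun _ _ => diagBand_apply_ne d
  rw [Module.End.mem_eigenspace_iff]
  change pair.act (diagBand d) (word l) = _
  induction l with
  | nil =>
    refine (FermionPair.act_diag_of_mem_states_Iic hd vacuum_mem_states).trans ?_
    rw [Finset.Ioc_self, Finset.sum_empty, sub_zero, List.map_nil, List.sum_nil]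
    rfl
  | cons k l ih =>
    rw [word_cons, List.map_cons, List.sum_cons, add_smul, modeWeight]
    split_ifs with hk
    · rw [phi_eq_pair_a hk, FermionPair.act_diag_a hd, ih, map_smul, diagBand_apply_self, add_comm]
    · rw [phi_eq_pair_b hk, FermionPair.act_diag_b hd, ih, map_smul, diagBand_apply_self,
        neg_smul, sub_eq_neg_add]

theorem sum_modeWeight_one (l : List ℤ) : (l.map (modeWeight fun _ => 1)).sum = (deg l : ℂ) := by
  induction l with
  | nil => simp [deg]
  | cons k l ih =>
    rw [List.map_cons, List.sum_cons, ih, deg_cons, modeWeight]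
    push_cast
    rfl

theorem homog_le_charge (n : ℤ) : homog n ≤ pair.charge n := by
  refine Submodule.span_le.mpr ?_
  rintro _ ⟨l, -, rfl, rfl⟩
  rw [SetLike.mem_coe, FermionPair.charge, ← sum_modeWeight_one]
  exact word_mem_eigenspace _ l

theorem iSupIndep_homog : iSupIndep homog := pair.iSupIndep_charge.mono homog_le_charge

theorem vacuum_mem_homog : vacuum ∈ homog 0 :=
  Submodule.subset_span ⟨[], ⟨List.Pairwise.nil, fun _ h => absurd h List.not_mem_nil⟩, rfl, rfl⟩

theorem iSup_homog : ⨆ n, homog n = ⊤ := by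
  have hphi (k : ℤ) : ⨆ n, homog n ≤ (⨆ n, homog n).comap (phi k) :=
    iSup_le fun n w hw => Submodule.mem_iSup_of_mem _ (phi_mem hw k)
  refine eq_top_iff.mpr fun v _ => ?_
  induction v using fock_induction with
  | h0 => exact Submodule.zero_mem _
  | hv => exact Submodule.mem_iSup_of_mem 0 vacuum_mem_homog
  | ha v w hv hw => exact Submodule.add_mem _ (hv trivial) (hw trivial)
  | hs t v hv => exact Submodule.smul_mem _ _ (hv trivial)
  | ho k v hv => exact hphi k (hv trivial)

theorem homog_eq_charge (n : ℤ) : homog n = pair.charge n := by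
  refine (homog_le_charge n).antisymm (eigenspace_le_of_sup_eq_top (homog_le_charge n) ?_)
  rw [eq_top_iff, ← iSup_homog]
  refine iSup_le fun m => ?_
  obtain rfl | hmn := eq_or_ne m n
  · exact le_sup_left
  · refine le_sup_of_le_right ((homog_le_charge m).trans ?_)
    exact le_iSup₂_of_le (m : ℂ) (Int.cast_injective.ne hmn) le_rfl

/-! ### Uniqueness of the vacuum -/

/-- The diagonal matrix with entries `2 i - 1/2` gives `φ_{k - 1/2}` the energy `1/2 - k`, which is
positive for all creation operators. -/
theorem modeWeight_energy (k : ℤ) :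
    modeWeight (fun i => 2 * i - 1 / 2) k = ((1 / 2 - k : ℝ) : ℂ) := by
  rw [modeWeight]
  split_ifs with hk
  · obtain ⟨j, rfl⟩ := hk
    rw [show (1 - (2 * j + 1)) / 2 = -j by omega]
    push_cast
    ring
  · obtain ⟨j, rfl⟩ := (Int.not_odd_iff_even.mp hk).two_dvd
    rw [Int.mul_ediv_cancel_left j two_ne_zero]
    push_cast
    ring

theorem sum_energy_ne_zero {l : List ℤ} (hl : ∀ k ∈ l, k ≤ 0) (hne : l ≠ []) :
    (l.map (modeWeight fun i => 2 * i - 1 / 2)).sum ≠ 0 := by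
  have hsum : (l.map (modeWeight fun i => 2 * i - 1 / 2)).sum =
      ((l.map fun k : ℤ => (1 / 2 - k : ℝ)).sum : ℝ) := by
    rw [← Complex.ofRealHom_eq_coe, map_list_sum, List.map_map]
    exact congrArg List.sum (List.map_congr_left fun k _ => modeWeight_energy k)
  rw [hsum, Complex.ofReal_ne_zero]
  refine (List.sum_pos _ (fun x hx => ?_) (mt List.map_eq_nil_iff.mp hne)).ne'
  obtain ⟨k, hk, rfl⟩ := List.mem_map.mp hx
  have : (k : ℝ) ≤ 0 := by exact_mod_cast hl k hk
  linarith

theorem states_Iic_zero : pair.states (Set.Iic 0) = ℂ ∙ vacuum := by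
  set f := pair.actHom (diagBand fun i => 2 * i - 1 / 2)
  have hstates : pair.states (Set.Iic 0) ≤ f.eigenspace 0 := by
    intro v hv
    have h := FermionPair.act_diag_of_mem_states_Iic
      (fun _ _ => diagBand_apply_ne fun i => 2 * i - 1 / 2) hv
    rw [Finset.Ioc_self, Finset.sum_empty, sub_zero] at h
    exact Module.End.mem_eigenspace_iff.mpr h
  have hvac : ℂ ∙ vacuum ≤ pair.states (Set.Iic 0) :=
    (Submodule.span_singleton_le_iff_mem _ _).mpr vacuum_mem_states
  refine le_antisymm (hstates.trans ?_) hvac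
  refine eigenspace_le_of_sup_eq_top (hvac.trans hstates) ?_
  rw [eq_top_iff, ← iSup_homog]
  refine iSup_le fun n => Submodule.span_le.mpr ?_
  rintro _ ⟨l, hl, -, rfl⟩
  obtain rfl | hne := eq_or_ne l []
  · exact Submodule.mem_sup_left (Submodule.mem_span_singleton_self vacuum)
  · refine Submodule.mem_sup_right ?_
    exact Submodule.mem_iSup_of_mem _
      (Submodule.mem_iSup_of_mem (sum_energy_ne_zero hl.2 hne) (word_mem_eigenspace _ l))

theorem finrank_states_Iic (n : ℤ) : Module.finrank ℂ (pair.states (Set.Iic n)) = 1 := by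
  rw [FermionPair.finrank_states_Iic, states_Iic_zero, finrank_span_singleton vacuum_ne_zero]

/-! ### The components as highest weight modules -/

theorem stable_of_lieSubmodule (N : LieSubmodule ℂ AInf NeutralFock) :
    pair.Stable N.toSubmodule := by
  intro i j v hv
  have h := N.lie_mem (x := AInf.ofMat (E i j)) hv
  rw [lie_eq] at h
  change pair.act (E i j) v + (0 : ℂ) • v ∈ N at h
  rwa [zero_smul, add_zero, pair.act_E] at h

theorem exists_mem_component_states (n : ℤ) :
    ∃ v : component n, v ≠ 0 ∧ (v : NeutralFock) ∈ pair.states (Set.Iic n) := by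
  have : Nontrivial (pair.states (Set.Iic n)) :=
    Module.nontrivial_of_finrank_pos (R := ℂ) (by rw [finrank_states_Iic]; exact one_pos)
  obtain ⟨⟨v, hv⟩, hv0⟩ := exists_ne (0 : pair.states (Set.Iic n))
  have hvn : v ∈ homog n := homog_eq_charge n ▸ pair.states_Iic_le_charge n hv
  refine ⟨⟨v, hvn⟩, fun h => hv0 (Subtype.ext ?_), hv⟩
  exact congrArg (fun w : component n => (w : NeutralFock)) h

theorem isIrreducible_component (n : ℤ) : LieModule.IsIrreducible ℂ AInf (component n) := by
  obtain ⟨v, hv0, -⟩ := exists_mem_component_states n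
  have : Nontrivial (component n) := ⟨v, 0, hv0⟩
  refine LieModule.IsIrreducible.mk fun N hN => eq_top_iff.mpr fun w _ => ?_
  obtain ⟨x, hx, hx0⟩ : ∃ x ∈ N, x ≠ 0 := by
    contrapose! hN
    exact (LieSubmodule.eq_bot_iff N).mpr hN
  have hle : pair.charge n ≤ (N.map (component n).incl).toSubmodule :=
    FermionPair.charge_le_of_stable (finrank_states_Iic 0) (stable_of_lieSubmodule _)
      ⟨x, hx, rfl⟩ (homog_le_charge n x.2) fun h => hx0 (Subtype.ext h)
  obtain ⟨w', hw', h⟩ := hle (homog_le_charge n w.2)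
  exact (Subtype.ext h : w' = w) ▸ hw'

theorem isHighestWeightVector_of_mem_states {n : ℤ} {v : component n} (hv0 : v ≠ 0)
    (hv : (v : NeutralFock) ∈ pair.states (Set.Iic n)) :
    IsHighestWeightVector (weightHat n) v where
  ne_zero := hv0
  upper_lie x hx := Subtype.ext <| by
    change ⁅x, (v : NeutralFock)⁆ = 0
    rw [lie_eq, hx.1, zero_smul, add_zero, FermionPair.act_eq_zero_of_mem_states_Iic hv hx.2]
  cartan_lie h := Subtype.ext <| by
    change ⁅h.1, (v : NeutralFock)⁆ = weightHat n h • (v : NeutralFock)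
    rw [lie_eq, FermionPair.act_diag_of_mem_states_Iic h.2 hv, ← add_smul]
    simp only [weightHat, weight, LinearMap.add_apply, LinearMap.sub_apply, LinearMap.sum_apply]
    rfl

theorem nonempty_component_equiv (n : ℤ) :
    Nonempty (component n ≃ₗ⁅ℂ, AInf⁆ Irr (weightHat n)) := by
  have := isIrreducible_component n
  obtain ⟨v, hv0, hv⟩ := exists_mem_component_states n
  exact (isHighestWeightVector_of_mem_states hv0 hv).nonempty_equiv_irr

theorem isInternal_component :
    DirectSum.IsInternal fun n : ℤ => (component n).toSubmodule :=
  (DirectSum.isInternal_submodule_iff_iSupIndep_and_iSup_eq_top _).mpr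
    ⟨iSupIndep_homog, iSup_homog⟩

theorem nonempty_equiv_directSum :
    Nonempty (NeutralFock ≃ₗ⁅ℂ, AInf⁆ DirectSum ℤ fun n => Irr (weightHat n)) :=
  ⟨(directSumLieEquivOfIsInternal isInternal_component).symm.trans
    (directSumLieEquivCongr fun n => (nonempty_component_equiv n).some)⟩

theorem c_lie (v : NeutralFock) : ⁅AInf.c, v⁆ = v := by
  change pair.act 0 v + (1 : ℂ) • v = v
  rw [pair.act_zero, zero_add, one_smul]

end NeutralFock

theorem ChargedFock.c_lie (v : ChargedFock) : ⁅AInf.c, v⁆ = v := by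
  change ChargedFock.pair.act 0 v + (1 : ℂ) • v = v
  rw [ChargedFock.pair.act_zero, zero_add, one_smul]

end

end FermionFock

/-- The decomposition of the Fock space of a single neutral fermion, as a module over `a_∞` with
central charge `1`, and its isomorphism with the Fock space of a pair of charged fermions. -/
theorem theorem3p7 :
    (∀ v : FermionFock.NeutralFock, ⁅FermionFock.AInf.c, v⁆ = v) ∧
    (∀ n : ℤ, LieModule.IsIrreducible ℂ FermionFock.AInf (FermionFock.NeutralFock.component n)) ∧
    (∀ n : ℤ, Nonempty (FermionFock.NeutralFock.component n ≃ₗ⁅ℂ,FermionFock.AInf⁆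
      FermionFock.Irr (FermionFock.weightHat n))) ∧
    DirectSum.IsInternal (fun n : ℤ => (FermionFock.NeutralFock.component n).toSubmodule) ∧
    Nonempty (FermionFock.NeutralFock ≃ₗ⁅ℂ,FermionFock.AInf⁆
      DirectSum ℤ fun n => FermionFock.Irr (FermionFock.weightHat n)) ∧
    (∀ v : FermionFock.ChargedFock, ⁅FermionFock.AInf.c, v⁆ = v) ∧
    Nonempty (FermionFock.NeutralFock ≃ₗ⁅ℂ,FermionFock.AInf⁆ FermionFock.ChargedFock) := by
  exact ⟨FermionFock.NeutralFock.c_lie, FermionFock.NeutralFock.isIrreducible_component,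
    FermionFock.NeutralFock.nonempty_component_equiv, FermionFock.NeutralFock.isInternal_component,
    FermionFock.NeutralFock.nonempty_equiv_directSum, FermionFock.ChargedFock.c_lie,
    ⟨FermionFock.chargedLieEquivNeutral.symm⟩⟩
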